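/- Let $X$ and $L$ be independent real random variables on a probability space, with $X>0$ almost surely, $X$, $X^{-1}$ and $L$ integrable, $\mathbb E[X]=1$ and $\mathbb E[L]=0$. Let $L$ have a bounded, strictly positive density $f_L$. Fix $\alpha\in(0,1)$ and put $q:=F_L^{-1}(1-\alpha)$, where $F_L$ is the distribution function of $L$. Assume that $f_L$ is differentiable in a neighbourhood of $q$ and that $f_L'$ is differentiable at $q$. For a random variable $Z$ let $\mathrm{VaR}_\beta[Z]=\inf\{m\in\mathbb R:\ \mathbb P(Z+m<0)\le\beta\}$ and $\mathrm{ES}_\alpha[Z]=\frac1\alpha\int_0^\alpha \mathrm{VaR}_\beta[Z]\,d\beta$. For $\sigma\ge0$ let $S_\sigma(\phi)=\phi\,(X_\sigma-1)-X_\sigma L$, where the family of assets $(X_\sigma)$ is one of the following two. * Log-normal volatility: assume $\mathrm{Var}[\ln X]>0$, and put $Y=(\ln X-\mathbb E[\ln X])/\sqrt{\mathrm{Var}[\ln X]}$ and $X_\sigma=e^{\sigma Y}/\mathbb E[e^{\sigma Y}]$. * Normal volatility: assume $\mathrm{Var}[X]>0$ and $\mathbb E[X^4]<\infty$, and put $Y=(X-1)/\sqrt{\mathrm{Var}[X]}$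 and $X_\sigma=1+\sigma Y$. In each case let $\mu_i=\mathbb E[Y^i]$, and write $\mathrm{id}$ for the identity function on $\mathbb R$. Then, for every $\phi\in\mathbb R$, as $\sigma\downarrow0$: in the log-normal case $$\mathrm{ES}_\alpha[S_\sigma(\phi)]=\mathrm{ES}_\alpha[-L]+\frac{\sigma^2}{2\alpha}(\phi-q)^2f_L(q)+\frac{\sigma^3\mu_3}{6\alpha}(\phi-q)^3f_L'(q)$$ $$\qquad+\frac{\sigma^4}{24\alpha}\Big[\mu_4\big((\phi-\mathrm{id})^4f_L'\big)'-3\,\frac{\big(((\phi-\mathrm{id})^2f_L)'\big)^2}{f_L}+(2\mu_4-6)(\phi-\mathrm{id})^3f_L'+(\mu_4+3)(\phi-\mathrm{id})^2f_L\Big](q)+o(\sigma^4);$$ in the normal case $$\mathrm{ES}_\alpha[S_\sigma(\phi)]=\mathrm{ES}_\alpha[-L]+\frac{\sigma^2}{2\alpha}(\phi-q)^2f_L(q)+\frac{\sigma^3\mu_3}{6\alpha}\big((\phi-\mathrm{id})^3f_L\big)'(q)$$ $$\qquad+\frac{\sigma^4}{24\alpha}\Big[\mu_4\big((\phi-\mathrm{id})^4f_L\big)''-3\,\frac{\big(((\phi-\mathrm{id})^2f_L)'\big)^2}{f_L}\Big](q)+o(\sigma^4).$$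 -/

import Mathlib

open MeasureTheory ProbabilityTheory Filter Topology Asymptotics

noncomputable section

/-- Value-at-risk at level `β` of a financial position `Z` (gains positive):
the smallest amount `m` of cash such that `Z + m` is negative with probability at most `β`. -/
def valueAtRisk {Ω : Type*} [MeasurableSpace Ω] (P : Measure Ω) (β : ℝ) (Z : Ω → ℝ) : ℝ :=
  sInf {m : ℝ | P.real {ω | Z ω + m < 0} ≤ β}

/-- Expected shortfall at level `α`: the average `α⁻¹ ∫₀^α VaR_β[Z] dβ`. -/
def expectedShortfall {Ω : Type*} [MeasurableSpace Ω] (P : Measure Ω) (α : ℝ) (Z : Ω → ℝ) : ℝ :=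
  α⁻¹ * ∫ β in (0 : ℝ)..α, valueAtRisk P β Z

/-- The `p`-quantile `F⁻¹(p)` of a law `ν` on `ℝ` with distribution function `F = cdf ν`. -/
def lawQuantile (ν : Measure ℝ) (p : ℝ) : ℝ :=
  sInf {x : ℝ | p ≤ cdf ν x}

/-- The surplus `S(φ) = φ (X - 1) - X L`. -/
def surplus {Ω : Type*} (X L : Ω → ℝ) (φ : ℝ) : Ω → ℝ :=
  fun ω => φ * (X ω - 1) - X ω * L ω

/-- The centred and normalized version `(Z - E Z) / √Var Z` of a random variable. -/
def standardized {Ω : Type*} [MeasurableSpace Ω] (P : Measure Ω) (Z : Ω → ℝ) : Ω → ℝ :=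
  fun ω => (Z ω - ∫ ω', Z ω' ∂P) / √(variance Z P)

/-- The `i`-th centred normalized moment `E[((Z - E Z) / √Var Z)^i]`. -/
def stdMoment {Ω : Type*} [MeasurableSpace Ω] (P : Measure Ω) (Z : Ω → ℝ) (i : ℕ) : ℝ :=
  ∫ ω, standardized P Z ω ^ i ∂P

/-- The version `1 + σ Y` of the unit-mean asset `X` with normal volatility `σ`,
where `Y` is the standardization of `X`. -/
def normalAsset {Ω : Type*} [MeasurableSpace Ω] (P : Measure Ω) (X : Ω → ℝ) (σ : ℝ) : Ω → ℝ :=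
  fun ω => 1 + σ * standardized P X ω

/-- The unit-mean version `exp (σ Y) / E[exp (σ Y)]` of the asset `X` with log-normal
volatility `σ`, where `Y` is the standardization of `log X`. -/
def logNormalAsset {Ω : Type*} [MeasurableSpace Ω] (P : Measure Ω) (X : Ω → ℝ) (σ : ℝ) : Ω → ℝ :=
  fun ω => Real.exp (σ * standardized P (fun ω' => Real.log (X ω')) ω) /
    mgf (standardized P (fun ω' => Real.log (X ω'))) P σ

end

/-! Expected shortfall is a minimum: `α * ES` is the least value over `m` of `α m + E[(-S - m)⁺]`,
attained at the `1 - α` quantile of the loss (`mul_expectedShortfall_le`,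
`mul_expectedShortfall_eq`). Conditioning on the asset `W` turns the excess into `E[W π(φ + (m - φ)
/ W)]`, where `π` is the stop-loss transform of `L`, with `π' = F - 1`, `π'' = f`.

With `m = q + B`, the argument of `π` is `q + h`, `h = (q + B - φ)(W⁻¹ - 1) + B`. Expand `π` to
fourth order at `q`. Since `E[W] = 1`, the linear term contributes `-α B`, which cancels the change
in `α m`; the rest involves only the moments `E[W (W⁻¹ - 1)^k]`, `k = 2, 3, 4`.

The optimal `m` moves at scale `σ²`. Setting `B = c σ²`, subtracting the terms through order `σ³`
and dividing by `σ⁴` leaves functions convex in `c` that converge pointwise to a parabola. Their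
minima then converge to the minimum of the parabola (`tendsto_min_of_convexOn`); completing the
square yields the negative quotient by `f_L`. Expanding the three moments for each family finishes
the proof. -/

/-! ### Quantile functions and transport of the uniform law -/

section Quantile

variable {ν : Measure ℝ}

/-- The Galois connection between quantiles and the distribution function. -/
lemma lawQuantile_le_iff {p : ℝ} (hp : p ∈ Set.Ioo (0 : ℝ) 1) (x : ℝ) :
    lawQuantile ν p ≤ x ↔ p ≤ cdf ν x := by
  set S : Set ℝ := {x : ℝ | p ≤ cdf ν x} with hS
  have hne : S.Nonempty :=
    (((tendsto_cdf_atTop ν).eventually (eventually_gt_nhds hp.2)).exists).imp fun _ h => h.le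
  have hbdd : BddBelow S := by
    obtain ⟨b, hb⟩ := ((tendsto_cdf_atBot ν).eventually (eventually_lt_nhds hp.1)).exists
    refine ⟨b, fun y hy => ?_⟩
    by_contra! h
    exact absurd (le_trans hy (monotone_cdf ν h.le)) (not_le.2 hb)
  refine ⟨fun h => ?_, fun h => csInf_le hbdd h⟩
  refine le_trans ?_ (monotone_cdf ν h)
  -- The infimum belongs to `S` by right continuity, as every point to its right does.
  have hright : Tendsto (cdf ν) (𝓝[>] (sInf S)) (𝓝 (cdf ν (sInf S))) :=
    ((cdf ν).right_continuous (sInf S)).tendsto.mono_left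
      (nhdsWithin_mono _ Set.Ioi_subset_Ici_self)
  refine ge_of_tendsto hright ?_
  filter_upwards [self_mem_nhdsWithin] with y hy
  obtain ⟨z, hz, hzy⟩ := (csInf_lt_iff hbdd hne).1 hy
  exact le_trans hz (monotone_cdf ν hzy.le)

lemma monotoneOn_lawQuantile : MonotoneOn (lawQuantile ν) (Set.Ioo 0 1) := by
  intro p hp p' hp' h
  rw [lawQuantile_le_iff hp]
  exact h.trans ((lawQuantile_le_iff hp' _).1 le_rfl)

lemma aemeasurable_lawQuantile :
    AEMeasurable (lawQuantile ν) (volume.restrict (Set.Ioo (0 : ℝ) 1)) :=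
  aemeasurable_restrict_of_monotoneOn measurableSet_Ioo monotoneOn_lawQuantile

variable [IsProbabilityMeasure ν]

/-- The quantile function transports the uniform law on the unit interval to `ν`. -/
lemma map_lawQuantile :
    (volume.restrict (Set.Ioo (0 : ℝ) 1)).map (lawQuantile ν) = ν := by
  refine Measure.ext_of_Iic _ _ fun a => ?_
  rw [Measure.map_apply_of_aemeasurable aemeasurable_lawQuantile measurableSet_Iic,
    ← ofReal_cdf, Measure.restrict_apply₀'  measurableSet_Ioo.nullMeasurableSet]
  have h : lawQuantile ν ⁻¹' Set.Iic a ∩ Set.Ioo 0 1 = Set.Iic (cdf ν a) ∩ Set.Ioo 0 1 := by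
    ext p
    simp only [Set.mem_inter_iff, Set.mem_preimage, Set.mem_Iic, and_congr_left_iff]
    exact fun hp => lawQuantile_le_iff hp a
  rw [h]
  have h0 := cdf_nonneg ν a
  have h1 := cdf_le_one ν a
  -- The two sets can differ only at the point 1, when `cdf ν a = 1`.
  have h2 : (Set.Iic (cdf ν a) ∩ Set.Ioo (0 : ℝ) 1 : Set ℝ) =ᵐ[volume] Set.Ioc 0 (cdf ν a) := by
    have : ∀ᵐ x : ℝ, x ≠ 1 := by simp [ae_iff, measure_singleton]
    filter_upwards [this] with x hx
    refine propext ⟨fun h => ⟨h.2.1, h.1⟩, fun h => ⟨h.2, h.1, lt_of_le_of_ne (h.2.trans h1) hx⟩⟩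
  rw [measure_congr h2, Real.volume_Ioc, sub_zero]



lemma integrableOn_lawQuantile (hν : Integrable (fun x : ℝ => x) ν) :
    IntegrableOn (lawQuantile ν) (Set.Ioo 0 1) := by
  have h : Integrable (fun x : ℝ => x) ((volume.restrict (Set.Ioo (0 : ℝ) 1)).map (lawQuantile ν)) := by
    rwa [map_lawQuantile]
  exact (integrable_map_measure aestronglyMeasurable_id aemeasurable_lawQuantile).1 h

lemma setIntegral_lawQuantile_sub_posPart (m : ℝ) :
    ∫ p in Set.Ioo (0 : ℝ) 1, max (lawQuantile ν p - m) 0 = ∫ x, max (x - m) 0 ∂ν := by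
  conv_rhs => rw [← map_lawQuantile (ν := ν)]
  rw [integral_map aemeasurable_lawQuantile (by fun_prop)]

end Quantile

/-! ### Expected shortfall as a minimum over retentions -/

section ExpectedShortfall

/-- The expected excess `∫ (x - m)⁺ dν` of a law `ν` over the retention `m`. -/
noncomputable def stopLoss (ν : Measure ℝ) (m : ℝ) : ℝ := ∫ x, max (x - m) 0 ∂ν

/-- Bound `Q - m` by its positive part, then enlarge the interval to `(0, 1)`, where transport
identifies the integral with the stop-loss. -/
lemma integral_lawQuantile_le {ν : Measure ℝ} [IsProbabilityMeasure ν]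
    (hν : Integrable (fun x : ℝ => x) ν) {α : ℝ} (hα : α ∈ Set.Ioo (0 : ℝ) 1) (m : ℝ) :
    ∫ p in Set.Ioo (1 - α) 1, lawQuantile ν p ≤ α * m + stopLoss ν m := by
  have hsub : Set.Ioo (1 - α) 1 ⊆ Set.Ioo (0 : ℝ) 1 :=
    Set.Ioo_subset_Ioo_left (by linarith [hα.2])
  have hQ := integrableOn_lawQuantile hν
  have hpos : IntegrableOn (fun p => max (lawQuantile ν p - m) 0) (Set.Ioo 0 1) :=
    (hQ.sub (integrable_const m)).pos_part
  have h1 : ∫ p in Set.Ioo (1 - α) 1, (lawQuantile ν p - m) ≤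
      ∫ p in Set.Ioo (1 - α) 1, max (lawQuantile ν p - m) 0 :=
    integral_mono ((hQ.mono_set hsub).sub (integrable_const m)) (hpos.mono_set hsub)
      fun p => le_max_left _ _
  have h2 : ∫ p in Set.Ioo (1 - α) 1, max (lawQuantile ν p - m) 0 ≤
      ∫ p in Set.Ioo (0 : ℝ) 1, max (lawQuantile ν p - m) 0 :=
    setIntegral_mono_set hpos (Eventually.of_forall fun p => le_max_right _ _)
      (Eventually.of_forall hsub)
  rw [setIntegral_lawQuantile_sub_posPart] at h2
  rw [integral_sub (hQ.mono_set hsub) (integrable_const m)] at h1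
  simp only [integral_const, MeasurableSet.univ, measureReal_restrict_apply, Set.univ_inter,
    Real.volume_real_Ioo, sub_sub_cancel, max_eq_left hα.1.le, smul_eq_mul] at h1
  unfold stopLoss
  linarith

/-- At `m = Q(1 - α)` nothing is lost in the preceding bound: by monotonicity `Q - m` is nonnegative
above level `1 - α` and nonpositive below it. -/
lemma integral_lawQuantile_eq {ν : Measure ℝ} [IsProbabilityMeasure ν]
    (hν : Integrable (fun x : ℝ => x) ν) {α : ℝ} (hα : α ∈ Set.Ioo (0 : ℝ) 1) :
    ∫ p in Set.Ioo (1 - α) 1, lawQuantile ν p =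
      α * lawQuantile ν (1 - α) + stopLoss ν (lawQuantile ν (1 - α)) := by
  set m := lawQuantile ν (1 - α)
  have hαm : 1 - α ∈ Set.Ioo (0 : ℝ) 1 := ⟨by linarith [hα.2], by linarith [hα.1]⟩
  have hsub : Set.Ioo (1 - α) 1 ⊆ Set.Ioo (0 : ℝ) 1 := Set.Ioo_subset_Ioo_left hαm.1.le
  have hQ := integrableOn_lawQuantile hν
  have h1 : ∫ p in Set.Ioo (1 - α) 1, (lawQuantile ν p - m) =
      ∫ p in Set.Ioo (0 : ℝ) 1, max (lawQuantile ν p - m) 0 := by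
    rw [setIntegral_eq_of_subset_of_forall_sdiff_eq_zero measurableSet_Ioo hsub fun p hp =>
      max_eq_right (sub_nonpos.2 (monotoneOn_lawQuantile hp.1 hαm
        (not_lt.1 fun h => hp.2 ⟨h, hp.1.2⟩)))]
    refine setIntegral_congr_fun measurableSet_Ioo fun p hp => ?_
    exact (max_eq_left (sub_nonneg.2 (monotoneOn_lawQuantile hαm (hsub hp) hp.1.le))).symm
  rw [setIntegral_lawQuantile_sub_posPart, integral_sub (hQ.mono_set hsub) (integrable_const m)] at h1
  simp only [integral_const, MeasurableSet.univ, measureReal_restrict_apply, Set.univ_inter,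
    Real.volume_real_Ioo, sub_sub_cancel, max_eq_left hα.1.le, smul_eq_mul] at h1
  unfold stopLoss
  linarith

variable {Ω : Type*} [MeasurableSpace Ω] {P : Measure Ω}

lemma stopLoss_map {ℓ : Ω → ℝ} (hℓ : Measurable ℓ) (m : ℝ) :
    stopLoss (P.map ℓ) m = ∫ ω, max (ℓ ω - m) 0 ∂P :=
  integral_map hℓ.aemeasurable (by fun_prop)

variable [IsProbabilityMeasure P]

lemma valueAtRisk_eq_lawQuantile {Z : Ω → ℝ} (hZ : Measurable Z) (β : ℝ) :
    valueAtRisk P β Z = lawQuantile (P.map fun ω => - Z ω) (1 - β) := by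
  have hZ' : Measurable fun ω => - Z ω := hZ.neg
  have : IsProbabilityMeasure (P.map fun ω => - Z ω) :=
    Measure.isProbabilityMeasure_map hZ'.aemeasurable
  unfold valueAtRisk lawQuantile
  congr 1
  ext m
  have h : {ω | Z ω + m < 0} = ((fun ω => - Z ω) ⁻¹' Set.Iic m)ᶜ := by
    ext ω
    simp only [Set.mem_ofPred_eq, Set.mem_compl_iff, Set.mem_preimage, Set.mem_Iic, not_le]
    constructor <;> intro h <;> linarith
  rw [Set.mem_ofPred_eq, Set.mem_ofPred_eq, cdf_eq_real, h,
    probReal_compl_eq_one_sub (hZ' measurableSet_Iic),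
    map_measureReal_apply hZ' measurableSet_Iic]
  constructor <;> intro h <;> linarith

lemma mul_expectedShortfall {Z : Ω → ℝ} (hZ : Measurable Z) {α : ℝ} (hα : 0 < α) :
    α * expectedShortfall P α Z =
      ∫ p in Set.Ioo (1 - α) 1, lawQuantile (P.map fun ω => - Z ω) p := by
  unfold expectedShortfall
  rw [mul_inv_cancel_left₀ hα.ne']
  simp_rw [valueAtRisk_eq_lawQuantile hZ]
  rw [intervalIntegral.integral_comp_sub_left, sub_zero,
    intervalIntegral.integral_of_le (by linarith), integral_Ioc_eq_integral_Ioo]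

/-- The Rockafellar–Uryasev representation of expected shortfall as a minimum. -/
lemma mul_expectedShortfall_le {Z : Ω → ℝ} (hZ : Measurable Z) (hint : Integrable Z P)
    {α : ℝ} (hα : α ∈ Set.Ioo (0 : ℝ) 1) (m : ℝ) :
    α * expectedShortfall P α Z ≤ α * m + ∫ ω, max (- Z ω - m) 0 ∂P := by
  have hZ' : Measurable fun ω => - Z ω := hZ.neg
  have : IsProbabilityMeasure (P.map fun ω => - Z ω) :=
    Measure.isProbabilityMeasure_map hZ'.aemeasurable
  rw [mul_expectedShortfall hZ hα.1, ← stopLoss_map hZ']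
  exact integral_lawQuantile_le
    ((integrable_map_measure aestronglyMeasurable_id hZ.neg.aemeasurable).2 hint.neg) hα m

lemma mul_expectedShortfall_eq {Z : Ω → ℝ} (hZ : Measurable Z) (hint : Integrable Z P)
    {α : ℝ} (hα : α ∈ Set.Ioo (0 : ℝ) 1) {q : ℝ}
    (hq : q = lawQuantile (P.map fun ω => - Z ω) (1 - α)) :
    α * expectedShortfall P α Z = α * q + ∫ ω, max (- Z ω - q) 0 ∂P := by
  have hZ' : Measurable fun ω => - Z ω := hZ.neg
  have : IsProbabilityMeasure (P.map fun ω => - Z ω) :=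
    Measure.isProbabilityMeasure_map hZ'.aemeasurable
  rw [mul_expectedShortfall hZ hα.1, ← stopLoss_map hZ', hq]
  exact integral_lawQuantile_eq
    ((integrable_map_measure aestronglyMeasurable_id hZ.neg.aemeasurable).2 hint.neg) hα

end ExpectedShortfall

/-! ### Convergence of minima of convex functions -/

section Convex

/-- Minima of convex functions converging pointwise to a parabola converge to its minimum. -/
lemma tendsto_min_of_convexOn {K : ℝ → ℝ → ℝ} {l : Filter ℝ} {Q k c₀ : ℝ} {v : ℝ → ℝ}
    (hk : 0 < k) (hconv : ∀ᶠ σ in l, ConvexOn ℝ Set.univ (K σ))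
    (hlim : ∀ c, Tendsto (fun σ => K σ c) l (𝓝 (Q + k * (c - c₀) ^ 2)))
    (hle : ∀ᶠ σ in l, ∀ c, v σ ≤ K σ c) (heq : ∀ᶠ σ in l, ∃ c, v σ = K σ c) :
    Tendsto v l (𝓝 Q) := by
  have h0 : Tendsto (fun σ => K σ c₀) l (𝓝 Q) := by simpa using hlim c₀
  -- The values at `c₀ ± η` eventually exceed `K σ c₀` by an amount in `(0, 2kη²)`. Positivity
  -- controls `K` outside the window of radius `η`, the upper bound controls it inside.
  have key : ∀ η > 0, ∀ᶠ σ in l, K σ c₀ - 2 * (k * η ^ 2) ≤ v σ := by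
    intro η hη
    have hkη : 0 < k * η ^ 2 := by positivity
    have hr : Tendsto (fun σ => K σ (c₀ + η) - K σ c₀) l (𝓝 (k * η ^ 2)) := by
      simpa using (hlim (c₀ + η)).sub h0
    have hl : Tendsto (fun σ => K σ (c₀ - η) - K σ c₀) l (𝓝 (k * η ^ 2)) := by
      have := (hlim (c₀ - η)).sub h0
      convert this using 2
      ring
    filter_upwards [hconv, heq, hr.eventually (Ioo_mem_nhds hkη (by linarith : _ < 2 * (k * η ^ 2))),
      hl.eventually (Ioo_mem_nhds hkη (by linarith : _ < 2 * (k * η ^ 2)))] with σ hc ⟨c, hvc⟩ hr hl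
    rw [hvc]
    -- A convex function that has risen between `c₀` and `c₀ + e` stays above its value at `c₀`
    -- further out.
    have outer : ∀ e : ℝ, 0 < K σ (c₀ + e) - K σ c₀ → ∀ t : ℝ, 1 ≤ t →
        K σ c₀ ≤ K σ (c₀ + t * e) := by
      intro e he t ht
      have ht0 : 0 < t := by linarith
      have h := hc.2 (Set.mem_univ c₀) (Set.mem_univ (c₀ + t * e))
        (sub_nonneg.2 (inv_le_one_of_one_le₀ ht)) (inv_nonneg.2 ht0.le) (by ring)
      have he' : (1 - t⁻¹) • c₀ + t⁻¹ • (c₀ + t * e) = c₀ + e := by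
        simp only [smul_eq_mul]; field_simp; ring
      rw [he', smul_eq_mul, smul_eq_mul] at h
      have : 0 < t⁻¹ * (K σ (c₀ + t * e) - K σ c₀) := by nlinarith
      linarith [(mul_pos_iff_of_pos_left (inv_pos.2 ht0)).1 this]
    -- The point `c₀` lies between `c₀ + t e` and `c₀ - e`, so a low value at the former would force
    -- a large one at the latter.
    have inner : ∀ e : ℝ, K σ (c₀ - e) - K σ c₀ < 2 * (k * η ^ 2) → ∀ t : ℝ, 0 ≤ t → t ≤ 1 →
        K σ c₀ - 2 * (k * η ^ 2) ≤ K σ (c₀ + t * e) := by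
      intro e he t ht ht1
      have ht0 : 0 < 1 + t := by linarith
      have h := hc.2 (Set.mem_univ (c₀ + t * e)) (Set.mem_univ (c₀ - e))
        (inv_nonneg.2 ht0.le) (div_nonneg ht ht0.le)
        (by rw [← one_div, ← add_div, div_self ht0.ne'])
      have he' : (1 + t)⁻¹ • (c₀ + t * e) + (t / (1 + t)) • (c₀ - e) = c₀ := by
        simp only [smul_eq_mul]; field_simp; ring
      rw [he', smul_eq_mul, smul_eq_mul, inv_mul_eq_div, div_mul_eq_mul_div, ← add_div,
        le_div_iff₀ ht0] at h
      nlinarith [mul_le_mul_of_nonneg_left he.le ht]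
    rcases le_total c₀ c with h | h
    · rcases le_total (c - c₀) η with h' | h'
      · have := inner η hl.2 ((c - c₀) / η) (div_nonneg (by linarith) hη.le)
          ((div_le_one hη).2 h')
        rwa [div_mul_cancel₀ _ hη.ne', add_sub_cancel] at this
      · have := outer η hr.1 ((c - c₀) / η) ((one_le_div hη).2 h')
        rw [div_mul_cancel₀ _ hη.ne', add_sub_cancel] at this
        linarith
    · rcases le_total (c₀ - c) η with h' | h'
      · have := inner (-η) (by rw [sub_neg_eq_add]; exact hr.2) ((c₀ - c) / η)
          (div_nonneg (by linarith) hη.le) ((div_le_one hη).2 h')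
        rwa [mul_neg, div_mul_cancel₀ _ hη.ne', neg_sub, add_sub_cancel] at this
      · have := outer (-η) (by rw [← sub_eq_add_neg]; exact hl.1) ((c₀ - c) / η)
          ((one_le_div hη).2 h')
        rw [mul_neg, div_mul_cancel₀ _ hη.ne', neg_sub, add_sub_cancel] at this
        linarith
  refine tendsto_order.2 ⟨fun a ha => ?_, fun a ha => ?_⟩
  · obtain ⟨η, hη, hηa⟩ : ∃ η > 0, 2 * (k * η ^ 2) < (Q - a) / 2 := by
      -- This choice makes `2kη²` equal to `(Q - a) / 4`.
      refine ⟨√((Q - a) / (8 * k)), Real.sqrt_pos.2 (div_pos (by linarith) (by linarith)), ?_⟩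
      rw [Real.sq_sqrt (div_nonneg (by linarith) (by linarith))]
      field_simp
      linarith
    filter_upwards [key η hη, h0.eventually (eventually_gt_nhds (by linarith : (Q + a) / 2 < Q))]
      with σ h1 h2
    linarith
  · filter_upwards [hle, h0.eventually (eventually_lt_nhds ha)] with σ h1 h2
    exact (h1 c₀).trans_lt h2

end Convex

/-! ### Regularity and Taylor expansion of the stop-loss transform -/

section StopLoss

lemma abs_max_sub_zero_sub_le (x a b : ℝ) : |max (x - a) 0 - max (x - b) 0| ≤ |a - b| := by
  refine (abs_max_sub_max_le_abs _ _ _).trans ?_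
  rw [sub_sub_sub_cancel_left, abs_sub_comm]

lemma integrable_max_sub_zero {ν : Measure ℝ} [IsFiniteMeasure ν]
    (hν : Integrable (fun x : ℝ => x) ν) (m : ℝ) : Integrable (fun x : ℝ => max (x - m) 0) ν :=
  (hν.sub (integrable_const m)).pos_part

lemma abs_stopLoss_sub_le {ν : Measure ℝ} [IsProbabilityMeasure ν]
    (hν : Integrable (fun x : ℝ => x) ν) (a b : ℝ) :
    |stopLoss ν a - stopLoss ν b| ≤ |a - b| := by
  unfold stopLoss
  rw [← integral_sub (integrable_max_sub_zero hν a) (integrable_max_sub_zero hν b)]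
  refine (abs_integral_le_integral_abs).trans ?_
  calc ∫ x, |max (x - a) 0 - max (x - b) 0| ∂ν ≤ ∫ _, |a - b| ∂ν :=
        integral_mono_of_nonneg (Eventually.of_forall fun x => abs_nonneg _)
          (integrable_const _) (Eventually.of_forall fun x => abs_max_sub_zero_sub_le x a b)
    _ = |a - b| := by simp

/-- Differentiation under the integral: the integrand is 1-Lipschitz in `m`, with slope `-1` or `0`
off the null set `x = m`. -/
lemma hasDerivAt_stopLoss {ν : Measure ℝ} [IsProbabilityMeasure ν] [NullSingletonClass ν]
    (hν : Integrable (fun x : ℝ => x) ν) (m : ℝ) :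
    HasDerivAt (stopLoss ν) (cdf ν m - 1) m := by
  have hne : ∀ᵐ x ∂ν, x ≠ m := by simp [ae_iff, measure_singleton]
  have h : HasDerivAt (stopLoss ν) _ m := (hasDerivAt_integral_of_dominated_loc_of_lip (μ := ν) (s := Set.univ) (x₀ := m)
    (F := fun m x => max (x - m) 0) (F' := (Set.Ioi m).indicator fun _ => (-1 : ℝ))
    (bound := fun _ => 1) univ_mem (Eventually.of_forall fun m => by fun_prop)
    (integrable_max_sub_zero hν m)
    ((measurable_const.indicator measurableSet_Ioi).aestronglyMeasurable)
    (Eventually.of_forall fun x => LipschitzOnWith.of_dist_le_mul fun a _ b _ => by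
      simpa [Real.dist_eq] using abs_max_sub_zero_sub_le x a b)
    (integrable_const 1) ?_).2
  · refine h.congr_deriv ?_
    rw [integral_indicator_const _ measurableSet_Ioi, cdf_eq_real, ← Set.compl_Iic,
      probReal_compl_eq_one_sub measurableSet_Iic]
    simp
  · filter_upwards [hne] with x hx
    rcases lt_or_gt_of_ne hx with h | h
    · rw [Set.indicator_of_notMem (by simpa using h.le)]
      refine (hasDerivAt_const m (0 : ℝ)).congr_of_eventuallyEq ?_
      filter_upwards [eventually_gt_nhds h] with y hy
      exact max_eq_right (by linarith)
    · rw [Set.indicator_of_mem (by simpa using h)]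
      refine ((hasDerivAt_id m).const_sub x).congr_of_eventuallyEq ?_
      filter_upwards [eventually_lt_nhds h] with y hy
      exact max_eq_left (by simpa using hy.le)

lemma cdf_lawQuantile {ν : Measure ℝ} {p : ℝ} (hp : p ∈ Set.Ioo (0 : ℝ) 1)
    (hc : ContinuousAt (cdf ν) (lawQuantile ν p)) : cdf ν (lawQuantile ν p) = p := by
  refine le_antisymm ?_ ((lawQuantile_le_iff hp _).1 le_rfl)
  refine le_of_tendsto (hc.tendsto.mono_left nhdsWithin_le_nhds : Tendsto _ (𝓝[<] lawQuantile ν p) _) ?_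
  filter_upwards [self_mem_nhdsWithin] with x hx
  exact (not_le.1 (mt (lawQuantile_le_iff hp x).2 (not_le.2 hx))).le

variable {f : ℝ → ℝ} {ν : Measure ℝ} [IsProbabilityMeasure ν]

lemma integrable_of_withDensity (hf : Measurable f) (hfpos : ∀ y, 0 < f y)
    (hν : ν = volume.withDensity fun y => ENNReal.ofReal (f y)) : Integrable f := by
  refine ⟨hf.aestronglyMeasurable, ?_⟩
  rw [hasFiniteIntegral_iff_ofReal (Eventually.of_forall fun y => (hfpos y).le)]
  have h : ν Set.univ = 1 := measure_univ
  rw [hν, withDensity_apply _ MeasurableSet.univ, Measure.restrict_univ] at h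
  simp [h]

lemma cdf_eq_setIntegral (hf : Measurable f) (hfpos : ∀ y, 0 < f y)
    (hν : ν = volume.withDensity fun y => ENNReal.ofReal (f y)) (x : ℝ) :
    cdf ν x = ∫ y in Set.Iic x, f y := by
  rw [cdf_eq_real, measureReal_def, hν, withDensity_apply _ measurableSet_Iic,
    integral_eq_lintegral_of_nonneg_ae (Eventually.of_forall fun y => (hfpos y).le)
      hf.aestronglyMeasurable]

lemma hasDerivAt_cdf (hf : Measurable f) (hfpos : ∀ y, 0 < f y)
    (hν : ν = volume.withDensity fun y => ENNReal.ofReal (f y)) {x : ℝ}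
    (hx : ContinuousAt f x) : HasDerivAt (cdf ν) (f x) x := by
  have hint := integrable_of_withDensity hf hfpos hν
  have h := intervalIntegral.integral_hasDerivAt_right (a := x) (b := x)
    (by simp : IntervalIntegrable f volume x x) (hf.stronglyMeasurable.stronglyMeasurableAtFilter) hx
  have h2 : (fun y => cdf ν y) = fun y => cdf ν x + ∫ t in x..y, f t := by
    funext y
    rw [cdf_eq_setIntegral hf hfpos hν, cdf_eq_setIntegral hf hfpos hν,
      ← intervalIntegral.integral_Iic_sub_Iic hint.integrableOn hint.integrableOn]
    ring
  rw [show (cdf ν : ℝ → ℝ) = fun y => cdf ν x + ∫ t in x..y, f t from h2]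
  exact h.const_add _

/-- A function whose derivative is `o(xⁿ)` at `0` is constant up to `o(xⁿ⁺¹)`. -/
lemma isLittleO_pow_succ_of_hasDerivAt {u u' : ℝ → ℝ} {n : ℕ}
    (hu : ∀ᶠ x in 𝓝 (0 : ℝ), HasDerivAt u (u' x) x) (hu0 : u 0 = 0)
    (hu' : u' =o[𝓝 0] fun x => x ^ n) : u =o[𝓝 0] fun x => x ^ (n + 1) := by
  obtain ⟨ε, hε, h⟩ := Metric.eventually_nhds_iff_ball.1 hu
  have hn : 𝓝[Metric.ball (0 : ℝ) ε] 0 = 𝓝 0 :=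
    nhdsWithin_eq_nhds.2 (Metric.ball_mem_nhds _ hε)
  have := (convex_ball (0 : ℝ) ε).isLittleO_pow_succ_real (n := n) (Metric.mem_ball_self hε)
    (fun x hx => (h x hx).hasDerivWithinAt) (by simpa [hn] using hu')
  simpa [hn, hu0] using this

/-- The Taylor remainder of fourth order of the stop-loss transform at `q`. -/
noncomputable def stopLossRemainder (ν : Measure ℝ) (q α f₀ f₁ f₂ h : ℝ) : ℝ :=
  stopLoss ν (q + h) -
    (stopLoss ν q - α * h + f₀ / 2 * h ^ 2 + f₁ / 6 * h ^ 3 + f₂ / 24 * h ^ 4)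

/-- Differentiability of `f'` at `q` is a first-order expansion of `f'`. Integrating it three times,
through `f`, `cdf ν - 1` and the stop-loss, raises the order to four without continuity of `f''`. -/
lemma stopLossRemainder_isLittleO [NullSingletonClass ν] (hid : Integrable (fun x : ℝ => x) ν)
    (hf : Measurable f) (hfpos : ∀ y, 0 < f y)
    (hν : ν = volume.withDensity fun y => ENNReal.ofReal (f y)) {q α : ℝ}
    (hq : cdf ν q = 1 - α) (hf1 : ∀ᶠ y in 𝓝 q, DifferentiableAt ℝ f y)
    (hf2 : DifferentiableAt ℝ (deriv f) q) :
    stopLossRemainder ν q α (f q) (deriv f q) (deriv (deriv f) q) =o[𝓝 0] fun h => h ^ 4 := by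
  have hshift : Tendsto (fun h => q + h) (𝓝 0) (𝓝 q) := by
    simpa using (continuous_const_add q).tendsto (0 : ℝ)
  have hf1' := hshift.eventually hf1
  have d0 : (fun h => deriv f (q + h) - (deriv f q + deriv (deriv f) q * h))
      =o[𝓝 0] fun h => h ^ 1 := by
    have := hasDerivAt_iff_isLittleO_nhds_zero.1 hf2.hasDerivAt
    simp only [smul_eq_mul] at this
    simp only [pow_one]
    exact this.congr_left fun h => by ring
  have d1 : (fun h => f (q + h) - (f q + deriv f q * h + deriv (deriv f) q / 2 * h ^ 2))
      =o[𝓝 0] fun h => h ^ (1 + 1) := by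
    refine isLittleO_pow_succ_of_hasDerivAt ?_ (by simp) d0
    filter_upwards [hf1'] with h hh
    refine (hh.hasDerivAt.comp_const_add q h).sub ?_
    refine (((hasDerivAt_id' h).const_mul (deriv f q)).const_add (f q)).add
      (((hasDerivAt_id' h).pow 2).const_mul (deriv (deriv f) q / 2)) |>.congr_deriv ?_
    push_cast; ring
  have d2 : (fun h => (cdf ν (q + h) - 1) - (-α + f q * h + deriv f q / 2 * h ^ 2
      + deriv (deriv f) q / 6 * h ^ 3)) =o[𝓝 0] fun h => h ^ (1 + 1 + 1) := by
    refine isLittleO_pow_succ_of_hasDerivAt ?_ (by simp [hq]) d1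
    filter_upwards [hf1'] with h hh
    refine (((hasDerivAt_cdf hf hfpos hν hh.continuousAt).comp_const_add q h).sub_const 1).sub ?_
    refine ((((hasDerivAt_id' h).const_mul (f q)).const_add (-α)).add
      (((hasDerivAt_id' h).pow 2).const_mul (deriv f q / 2))).add
      (((hasDerivAt_id' h).pow 3).const_mul (deriv (deriv f) q / 6)) |>.congr_deriv ?_
    push_cast; ring
  refine isLittleO_pow_succ_of_hasDerivAt (Eventually.of_forall fun h => ?_)
    (by simp [stopLossRemainder]) d2
  refine ((hasDerivAt_stopLoss hid (q + h)).comp_const_add q h).sub ?_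
  refine (((((hasDerivAt_id' h).const_mul α).const_sub (stopLoss ν q)).add
      (((hasDerivAt_id' h).pow 2).const_mul (f q / 2))).add
      (((hasDerivAt_id' h).pow 3).const_mul (deriv f q / 6))).add
      (((hasDerivAt_id' h).pow 4).const_mul (deriv (deriv f) q / 24)) |>.congr_deriv ?_
  push_cast; ring

/-- A global bound, needed for dominated convergence. Away from 0 the Lipschitz stop-loss and the
lower powers of `|h|` are all dominated by `h ^ 4`. -/
lemma exists_abs_stopLossRemainder_le (hid : Integrable (fun x : ℝ => x) ν)
    {q α f₀ f₁ f₂ : ℝ}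
    (ho : stopLossRemainder ν q α f₀ f₁ f₂ =o[𝓝 0] fun h => h ^ 4) :
    ∃ C, ∀ h, |stopLossRemainder ν q α f₀ f₁ f₂ h| ≤ C * h ^ 4 := by
  obtain ⟨ε, hε, hb⟩ := Metric.eventually_nhds_iff_ball.1 (ho.def one_pos)
  refine ⟨1 + ((1 + |α|) / ε ^ 3 + |f₀| / ε ^ 2 + |f₁| / ε + |f₂|), fun h => ?_⟩
  have h4 : 0 ≤ h ^ 4 := by positivity
  have h4' : |h| ^ 4 = h ^ 4 := by rw [← abs_pow, abs_of_nonneg h4]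
  rcases lt_or_ge |h| ε with hh | hh
  · have := hb h (by simpa using hh)
    rw [Real.norm_eq_abs, Real.norm_eq_abs, abs_of_nonneg h4, one_mul] at this
    refine this.trans (le_mul_of_one_le_left h4 (le_add_of_nonneg_right (by positivity)))
  · have h1 : |h| ≤ h ^ 4 / ε ^ 3 := by
      rw [le_div_iff₀ (by positivity), ← h4', pow_succ' |h| 3]
      gcongr
    have h2 : |h| ^ 2 ≤ h ^ 4 / ε ^ 2 := by
      rw [le_div_iff₀ (by positivity), ← h4', show |h| ^ 4 = |h| ^ 2 * |h| ^ 2 by ring]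
      gcongr
    have h3 : |h| ^ 3 ≤ h ^ 4 / ε := by
      rw [le_div_iff₀ hε, ← h4', show |h| ^ 4 = |h| ^ 3 * |h| by ring]
      gcongr
    have hL : |stopLoss ν (q + h) - stopLoss ν q| ≤ |h| := by
      simpa using abs_stopLoss_sub_le hid (q + h) q
    have e : stopLossRemainder ν q α f₀ f₁ f₂ h = (stopLoss ν (q + h) - stopLoss ν q) + α * h
        - f₀ / 2 * h ^ 2 - f₁ / 6 * h ^ 3 - f₂ / 24 * h ^ 4 := by
      unfold stopLossRemainder; ring
    calc |stopLossRemainder ν q α f₀ f₁ f₂ h|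
        ≤ |h| + |α| * |h| + |f₀| * |h| ^ 2 + |f₁| * |h| ^ 3 + |f₂| * h ^ 4 := by
          rw [e]
          refine (abs_sub _ _).trans (add_le_add ((abs_sub _ _).trans (add_le_add
            ((abs_sub _ _).trans (add_le_add ((abs_add_le _ _).trans
              (add_le_add hL (abs_mul _ _).le)) ?_)) ?_)) ?_)
          · rw [abs_mul, abs_pow, abs_div, abs_two]
            gcongr
            exact div_le_self (abs_nonneg _) (by norm_num)
          · rw [abs_mul, abs_pow, abs_div]
            gcongr
            exact div_le_self (abs_nonneg _) (by norm_num)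
          · rw [abs_mul, abs_of_nonneg h4, abs_div]
            gcongr
            exact div_le_self (abs_nonneg _) (by norm_num)
      _ ≤ h ^ 4 / ε ^ 3 + |α| * (h ^ 4 / ε ^ 3) + |f₀| * (h ^ 4 / ε ^ 2) + |f₁| * (h ^ 4 / ε)
            + |f₂| * h ^ 4 := by gcongr
      _ = ((1 + |α|) / ε ^ 3 + |f₀| / ε ^ 2 + |f₁| / ε + |f₂|) * h ^ 4 := by ring
      _ ≤ _ := mul_le_mul_of_nonneg_right (le_add_of_nonneg_left zero_le_one) h4

end StopLoss

/-! ### Expected excess for an asset close to 1 -/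

section SmallVolatility

variable {Ω : Type*} [MeasurableSpace Ω] {P : Measure Ω}

/-- Fubini by independence, after factoring out `W > 0`: `W l - φ (W - 1) - m = W (l - (φ + (m - φ)
/ W))`. -/
lemma integral_posPart_eq_integral_mul_stopLoss [IsProbabilityMeasure P] {W L : Ω → ℝ} (hW : Measurable W)
    (hL : Measurable L) (hWL : IndepFun W L P) (hWpos : ∀ᵐ ω ∂P, 0 < W ω)
    (hWint : Integrable W P) (hLint : Integrable L P) (φ m : ℝ) :
    ∫ ω, max (- surplus W L φ ω - m) 0 ∂P =
      ∫ ω, W ω * stopLoss (P.map L) (φ + (m - φ) / W ω) ∂P := by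
  have hWL' := (indepFun_iff_map_prod_eq_prod_map_map hW.aemeasurable hL.aemeasurable).1 hWL
  have hPW : IsProbabilityMeasure (P.map W) := Measure.isProbabilityMeasure_map hW.aemeasurable
  have hPL : IsProbabilityMeasure (P.map L) := Measure.isProbabilityMeasure_map hL.aemeasurable
  set F : ℝ × ℝ → ℝ := fun x => max (x.1 * x.2 - φ * (x.1 - 1) - m) 0 with hF
  have hFm : Measurable F := by fun_prop
  have hFint : Integrable F ((P.map W).prod (P.map L)) := by
    rw [← hWL', integrable_map_measure hFm.aestronglyMeasurable (hW.prodMk hL).aemeasurable]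
    exact (((hWL.integrable_mul hWint hLint).sub
      ((hWint.sub (integrable_const 1)).const_mul φ)).sub (integrable_const m)).pos_part
  have h1 : ∫ ω, max (- surplus W L φ ω - m) 0 ∂P = ∫ x, F x ∂((P.map W).prod (P.map L)) := by
    rw [← hWL', integral_map (hW.prodMk hL).aemeasurable hFm.aestronglyMeasurable]
    refine integral_congr_ae (Eventually.of_forall fun ω => ?_)
    simp only [hF, surplus]
    congr 1
    ring
  rw [h1, integral_prod _ hFint, integral_map hW.aemeasurable
    hFm.stronglyMeasurable.integral_prod_right'.aestronglyMeasurable]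
  refine integral_congr_ae ?_
  filter_upwards [hWpos] with ω hω
  simp only [stopLoss, hF]
  rw [← integral_const_mul]
  refine integral_congr_ae (Eventually.of_forall fun l => ?_)
  simp only
  rw [mul_max_of_nonneg _ _ hω.le, mul_zero]
  congr 1
  field_simp
  ring

lemma integrable_mul_inv_sub_one_pow {W : Ω → ℝ} (hW : Measurable W)
    (hWpos : ∀ᵐ ω ∂P, 0 < W ω) (hWint : Integrable W P)
    (h4 : Integrable (fun ω => W ω * ((W ω)⁻¹ - 1) ^ 4) P) {n : ℕ} (hn : n ≤ 4) :
    Integrable (fun ω => W ω * ((W ω)⁻¹ - 1) ^ n) P := by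
  refine (hWint.add h4).mono' (by fun_prop) ?_
  filter_upwards [hWpos] with ω hω
  rw [Real.norm_eq_abs, abs_mul, abs_of_pos hω, abs_pow, Pi.add_apply]
  have hD : |(W ω)⁻¹ - 1| ^ n ≤ 1 + ((W ω)⁻¹ - 1) ^ 4 := by
    have e : |(W ω)⁻¹ - 1| ^ 4 = ((W ω)⁻¹ - 1) ^ 4 := by
      rw [← abs_pow, abs_of_nonneg (by positivity)]
    rw [← e]
    rcases le_total |(W ω)⁻¹ - 1| 1 with h | h
    · exact (pow_le_one₀ (abs_nonneg _) h).trans (le_add_of_nonneg_right (by positivity))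
    · exact (pow_le_pow_right₀ h hn).trans (le_add_of_nonneg_left zero_le_one)
  calc W ω * |(W ω)⁻¹ - 1| ^ n ≤ W ω * (1 + ((W ω)⁻¹ - 1) ^ 4) := by gcongr
    _ = _ := by ring

/-- Fourth order expansion of the expected excess in the moments `E[W (W⁻¹ - 1) ^ k]`. -/
lemma integral_mul_stopLoss_eq [IsProbabilityMeasure P] {W : Ω → ℝ} (hW : Measurable W)
    (hWpos : ∀ᵐ ω ∂P, 0 < W ω) (hWint : Integrable W P) (hEW : ∫ ω, W ω ∂P = 1)
    (h4 : Integrable (fun ω => W ω * ((W ω)⁻¹ - 1) ^ 4) P)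
    {ν : Measure ℝ} {q α f₀ f₁ f₂ : ℝ} (φ B : ℝ)
    (hr : Integrable (fun ω => W ω *
      stopLossRemainder ν q α f₀ f₁ f₂ ((q + B - φ) * ((W ω)⁻¹ - 1) + B)) P) :
    ∫ ω, W ω * stopLoss ν (φ + (q + B - φ) / W ω) ∂P =
      stopLoss ν q - α * B
      + f₀ / 2 * ((q + B - φ) ^ 2 * ∫ ω, W ω * ((W ω)⁻¹ - 1) ^ 2 ∂P) + f₀ / 2 * B ^ 2
      + f₁ / 6 * ((q + B - φ) ^ 3 * (∫ ω, W ω * ((W ω)⁻¹ - 1) ^ 3 ∂P)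
        + 3 * (q + B - φ) ^ 2 * B * (∫ ω, W ω * ((W ω)⁻¹ - 1) ^ 2 ∂P) + B ^ 3)
      + f₂ / 24 * ((q + B - φ) ^ 4 * (∫ ω, W ω * ((W ω)⁻¹ - 1) ^ 4 ∂P)
        + 4 * (q + B - φ) ^ 3 * B * (∫ ω, W ω * ((W ω)⁻¹ - 1) ^ 3 ∂P)
        + 6 * (q + B - φ) ^ 2 * B ^ 2 * (∫ ω, W ω * ((W ω)⁻¹ - 1) ^ 2 ∂P) + B ^ 4)
      + ∫ ω, W ω * stopLossRemainder ν q α f₀ f₁ f₂ ((q + B - φ) * ((W ω)⁻¹ - 1) + B) ∂P := by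
  set A := q + B - φ with hA
  have i2 := integrable_mul_inv_sub_one_pow hW hWpos hWint h4 (n := 2) (by norm_num)
  have i3 := integrable_mul_inv_sub_one_pow hW hWpos hWint h4 (n := 3) (by norm_num)
  -- Grouped by powers of `W⁻¹ - 1`; the first power carries the factor `W (W⁻¹ - 1) = 1 - W`, whose
  -- mean is zero.
  have key : ∀ᵐ ω ∂P, W ω * stopLoss ν (φ + A / W ω) =
      (((((stopLoss ν q - α * B + f₀ / 2 * B ^ 2 + f₁ / 6 * B ^ 3 + f₂ / 24 * B ^ 4) * W ω
      + (-α * A + f₀ * A * B + f₁ / 2 * A * B ^ 2 + f₂ / 6 * A * B ^ 3) * (1 - W ω))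
      + (f₀ / 2 * A ^ 2 + f₁ / 2 * A ^ 2 * B + f₂ / 4 * A ^ 2 * B ^ 2) *
          (W ω * ((W ω)⁻¹ - 1) ^ 2))
      + (f₁ / 6 * A ^ 3 + f₂ / 6 * A ^ 3 * B) * (W ω * ((W ω)⁻¹ - 1) ^ 3))
      + f₂ / 24 * A ^ 4 * (W ω * ((W ω)⁻¹ - 1) ^ 4))
      + W ω * stopLossRemainder ν q α f₀ f₁ f₂ (A * ((W ω)⁻¹ - 1) + B) := by
    filter_upwards [hWpos] with ω hω
    have e : φ + A / W ω = q + (A * ((W ω)⁻¹ - 1) + B) := by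
      rw [hA]; field_simp; ring
    have eW : 1 - W ω = W ω * ((W ω)⁻¹ - 1) := by field_simp
    rw [e, stopLossRemainder, eW]
    ring
  have j1 : Integrable (fun ω => 1 - W ω) P := (integrable_const 1).sub hWint
  rw [integral_congr_ae key, integral_add _ hr, integral_add _ (h4.const_mul _),
    integral_add _ (i3.const_mul _), integral_add _ (i2.const_mul _),
    integral_add (hWint.const_mul _) (j1.const_mul _)]
  · simp only [integral_const_mul]
    rw [integral_sub (integrable_const 1) hWint, hEW]
    simp only [integral_const, probReal_univ, smul_eq_mul, mul_one, sub_self, mul_zero]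
    ring
  · exact (hWint.const_mul _).add (j1.const_mul _)
  · exact ((hWint.const_mul _).add (j1.const_mul _)).add (i2.const_mul _)
  · exact (((hWint.const_mul _).add (j1.const_mul _)).add (i2.const_mul _)).add (i3.const_mul _)
  · exact ((((hWint.const_mul _).add (j1.const_mul _)).add (i2.const_mul _)).add
      (i3.const_mul _)).add (h4.const_mul _)

/-- A family of positive unit-mean assets `W σ` that degenerates to `1` as `σ ↓ 0`, with the
given expansions of the moments `E[W (W⁻¹ - 1) ^ k]`, `k = 2, 3, 4`, up to `o(σ⁴)`. -/
structure IsSmallVolatilityFamily (P : Measure Ω) (W : ℝ → Ω → ℝ) (b d e k m : ℝ) : Prop where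
  measurable : ∀ σ, Measurable (W σ)
  integrable : ∀ᶠ σ in 𝓝[>] 0, Integrable (W σ) P
  integral_eq : ∀ᶠ σ in 𝓝[>] 0, ∫ ω, W σ ω ∂P = 1
  dominated : ∃ G : Ω → ℝ, Integrable G P ∧ ∃ σ₀ > 0, ∀ᵐ ω ∂P, ∀ σ ∈ Set.Ioo 0 σ₀,
    0 < W σ ω ∧ W σ ω * ((W σ ω)⁻¹ - 1) ^ 4 ≤ σ ^ 4 * G ω
  tendsto_one : ∀ᵐ ω ∂P, Tendsto (fun σ => W σ ω) (𝓝[>] 0) (𝓝 1)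
  moment_two : (fun σ => (∫ ω, W σ ω * ((W σ ω)⁻¹ - 1) ^ 2 ∂P) - (σ ^ 2 + b * σ ^ 3 + d * σ ^ 4))
    =o[𝓝[>] 0] fun σ => σ ^ 4
  moment_three : (fun σ => (∫ ω, W σ ω * ((W σ ω)⁻¹ - 1) ^ 3 ∂P) - (e * σ ^ 3 + k * σ ^ 4))
    =o[𝓝[>] 0] fun σ => σ ^ 4
  moment_four : (fun σ => (∫ ω, W σ ω * ((W σ ω)⁻¹ - 1) ^ 4 ∂P) - m * σ ^ 4)
    =o[𝓝[>] 0] fun σ => σ ^ 4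

namespace IsSmallVolatilityFamily

variable {W : ℝ → Ω → ℝ} {b d e k m : ℝ}

lemma ae_pos (h : IsSmallVolatilityFamily P W b d e k m) :
    ∀ᶠ σ in 𝓝[>] 0, ∀ᵐ ω ∂P, 0 < W σ ω := by
  obtain ⟨G, -, σ₀, hσ₀, hG⟩ := h.dominated
  filter_upwards [Ioo_mem_nhdsGT hσ₀] with σ hσ
  filter_upwards [hG] with ω hω using (hω σ hσ).1

lemma integrable_four (h : IsSmallVolatilityFamily P W b d e k m) :
    ∀ᶠ σ in 𝓝[>] 0, Integrable (fun ω => W σ ω * ((W σ ω)⁻¹ - 1) ^ 4) P := by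
  obtain ⟨G, hGint, σ₀, hσ₀, hG⟩ := h.dominated
  filter_upwards [Ioo_mem_nhdsGT hσ₀] with σ hσ
  have := h.measurable σ
  refine (hGint.const_mul (σ ^ 4)).mono' (by fun_prop) ?_
  filter_upwards [hG] with ω hω
  rw [Real.norm_eq_abs, abs_of_nonneg (mul_nonneg (hω σ hσ).1.le (by positivity))]
  exact (hω σ hσ).2

/-- Domination of `W h⁴` for the shift `h = A (W⁻¹ - 1) + B`. -/
lemma exists_dominated_shift [IsProbabilityMeasure P] (h : IsSmallVolatilityFamily P W b d e k m) (a c : ℝ) :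
    ∃ G : Ω → ℝ, Integrable G P ∧ ∃ σ₀ > 0, ∀ᵐ ω ∂P, ∀ σ ∈ Set.Ioo 0 σ₀, 0 < W σ ω ∧
      W σ ω * ((a + c * σ ^ 2) * ((W σ ω)⁻¹ - 1) + c * σ ^ 2) ^ 4 ≤ σ ^ 4 * G ω := by
  obtain ⟨G, hGint, σ₀, hσ₀, hG⟩ := h.dominated
  refine ⟨fun ω => 8 * ((|a| + |c|) ^ 4 * G ω + c ^ 4 * (2 + 16 * G ω)),
    ((hGint.const_mul _).add (((integrable_const 2).add (hGint.const_mul 16)).const_mul _)).const_mul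
      8, min σ₀ 1, lt_min hσ₀ one_pos, ?_⟩
  filter_upwards [hG] with ω hω σ hσ
  have hσ1 : σ < 1 := hσ.2.trans_le (min_le_right _ _)
  have hσp : 0 < σ := hσ.1
  obtain ⟨hw, hb⟩ := hω σ ⟨hσ.1, hσ.2.trans_le (min_le_left _ _)⟩
  refine ⟨hw, ?_⟩
  set w := W σ ω
  set D := w⁻¹ - 1 with hD
  set A := a + c * σ ^ 2 with hA
  have hσ2 : σ ^ 2 ≤ 1 := pow_le_one₀ hσp.le hσ1.le
  have hσ4 : σ ^ 4 ≤ 1 := pow_le_one₀ hσp.le hσ1.le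
  have hGnn : 0 ≤ G ω := by
    have : 0 ≤ σ ^ 4 * G ω := le_trans (by positivity) hb
    exact nonneg_of_mul_nonneg_right this (by positivity)
  have hAle : A ^ 4 ≤ (|a| + |c|) ^ 4 := by
    rw [← Even.pow_abs (by decide : Even 4) A]
    refine pow_le_pow_left₀ (abs_nonneg _) ?_ 4
    refine (abs_add_le _ _).trans (add_le_add_right ?_ _)
    rw [abs_mul, abs_of_nonneg (by positivity : 0 ≤ σ ^ 2)]
    exact mul_le_of_le_one_right (abs_nonneg _) hσ2
  -- If `w ≥ 2` then `|w⁻¹ - 1| ≥ 1/2`, so `w / 16 ≤ w D⁴ ≤ G`; thus `G` also dominates `W` itself.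
  have hwle : w ≤ 2 + 16 * G ω := by
    rcases le_total w 2 with h2 | h2
    · linarith
    · have hDle : w * D ^ 4 ≤ G ω := hb.trans (mul_le_of_le_one_left hGnn hσ4)
      have hD2 : 1 / 2 ≤ -D := by
        have : w⁻¹ ≤ 2⁻¹ := inv_anti₀ two_pos h2
        rw [hD]; linarith
      have hD4 : (1 / 2) ^ 4 ≤ D ^ 4 := by
        rw [← Even.neg_pow (by decide : Even 4) D]
        exact pow_le_pow_left₀ (by norm_num) hD2 4
      nlinarith [mul_le_mul_of_nonneg_left hD4 hw.le]
  have hconv : (A * D + c * σ ^ 2) ^ 4 ≤ 8 * (A ^ 4 * D ^ 4 + (c * σ ^ 2) ^ 4) := by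
    have h1 := sq_nonneg (A * D - c * σ ^ 2)
    have h2 := sq_nonneg ((A * D) ^ 2 - (c * σ ^ 2) ^ 2)
    have h3 : (A * D + c * σ ^ 2) ^ 2 ≤ 2 * ((A * D) ^ 2 + (c * σ ^ 2) ^ 2) := by linarith
    calc (A * D + c * σ ^ 2) ^ 4 = ((A * D + c * σ ^ 2) ^ 2) ^ 2 := by ring
      _ ≤ (2 * ((A * D) ^ 2 + (c * σ ^ 2) ^ 2)) ^ 2 := pow_le_pow_left₀ (sq_nonneg _) h3 2
      _ ≤ _ := by linarith
  calc w * (A * D + c * σ ^ 2) ^ 4 ≤ w * (8 * (A ^ 4 * D ^ 4 + (c * σ ^ 2) ^ 4)) := by gcongr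
    _ = 8 * (A ^ 4 * (w * D ^ 4) + σ ^ 4 * (c ^ 4 * (σ ^ 4 * w))) := by ring
    _ ≤ 8 * ((|a| + |c|) ^ 4 * (σ ^ 4 * G ω) + σ ^ 4 * (c ^ 4 * (1 * (2 + 16 * G ω)))) := by
        gcongr
    _ = _ := by ring

/-- The Taylor remainder contributes `o(σ⁴)` to the expected excess. -/
lemma integral_remainder_isLittleO [IsProbabilityMeasure P] (h : IsSmallVolatilityFamily P W b d e k m) {r : ℝ → ℝ}
    (hrm : Measurable r) (ho : r =o[𝓝 0] fun x => x ^ 4) {C : ℝ} (hC : ∀ x, |r x| ≤ C * x ^ 4)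
    (a c : ℝ) :
    (∀ᶠ σ in 𝓝[>] 0, Integrable
      (fun ω => W σ ω * r ((a + c * σ ^ 2) * ((W σ ω)⁻¹ - 1) + c * σ ^ 2)) P) ∧
    Tendsto (fun σ => (∫ ω, W σ ω * r ((a + c * σ ^ 2) * ((W σ ω)⁻¹ - 1) + c * σ ^ 2) ∂P) / σ ^ 4)
      (𝓝[>] 0) (𝓝 0) := by
  obtain ⟨G, hGint, σ₀, hσ₀, hG⟩ := h.exists_dominated_shift a c
  have hC0 : 0 ≤ C := by simpa using (abs_nonneg _).trans (hC 1)
  have hb : ∀ᶠ σ in 𝓝[>] (0 : ℝ), ∀ᵐ ω ∂P,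
      ‖W σ ω * r ((a + c * σ ^ 2) * ((W σ ω)⁻¹ - 1) + c * σ ^ 2)‖ ≤ σ ^ 4 * (C * G ω) := by
    filter_upwards [Ioo_mem_nhdsGT hσ₀] with σ hσ
    filter_upwards [hG] with ω hω
    obtain ⟨hw, hle⟩ := hω σ hσ
    rw [Real.norm_eq_abs, abs_mul, abs_of_pos hw]
    refine (mul_le_mul_of_nonneg_left (hC _) hw.le).trans ?_
    nlinarith [mul_le_mul_of_nonneg_left hle hC0]
  have hmeas : ∀ σ, Measurable
      (fun ω => W σ ω * r ((a + c * σ ^ 2) * ((W σ ω)⁻¹ - 1) + c * σ ^ 2)) := fun σ =>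
    have := h.measurable σ
    (h.measurable σ).mul (hrm.comp (by fun_prop))
  constructor
  · filter_upwards [hb] with σ hσ
    exact ((hGint.const_mul C).const_mul (σ ^ 4)).mono' (hmeas σ).aestronglyMeasurable hσ
  -- For fixed `ω` the shift `h` tends to 0, so `W r(h) = o(W h⁴)`, while `W h⁴ ≤ σ⁴ G`.
  have hlim : ∀ᵐ ω ∂P, Tendsto (fun σ =>
      (W σ ω * r ((a + c * σ ^ 2) * ((W σ ω)⁻¹ - 1) + c * σ ^ 2)) / σ ^ 4) (𝓝[>] 0) (𝓝 0) := by
    filter_upwards [hG, h.tendsto_one] with ω hω h1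
    have hσ0 : Tendsto (fun σ : ℝ => σ) (𝓝[>] 0) (𝓝 0) := nhdsWithin_le_nhds
    have hcσ : Tendsto (fun σ : ℝ => c * σ ^ 2) (𝓝[>] 0) (𝓝 0) := by
      simpa using (hσ0.pow 2).const_mul c
    have hh : Tendsto (fun σ => (a + c * σ ^ 2) * ((W σ ω)⁻¹ - 1) + c * σ ^ 2) (𝓝[>] 0) (𝓝 0) := by
      simpa using ((hcσ.const_add a).mul ((h1.inv₀ one_ne_zero).sub_const 1)).add hcσ
    refine IsLittleO.tendsto_div_nhds_zero ?_
    refine (((isBigO_refl (fun σ => W σ ω) _).mul_isLittleO (ho.comp_tendsto hh))).trans_isBigO ?_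
    refine IsBigO.of_bound (G ω) ?_
    filter_upwards [Ioo_mem_nhdsGT hσ₀] with σ hσ
    obtain ⟨hw, hle⟩ := hω σ hσ
    rw [Real.norm_eq_abs, Real.norm_eq_abs, abs_of_nonneg (by positivity : 0 ≤ σ ^ 4), mul_comm]
    rw [mul_comm] at hle
    simp only [Function.comp_apply]
    rwa [abs_of_nonneg (mul_nonneg (by positivity) hw.le), mul_comm (G ω)]
  simp_rw [← integral_div]
  have hdct := tendsto_integral_filter_of_dominated_convergence (fun ω => C * G ω)
    (Eventually.of_forall fun σ => ((hmeas σ).div_const (σ ^ 4)).aestronglyMeasurable) ?_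
    (hGint.const_mul C) hlim
  · simpa using hdct
  filter_upwards [hb, self_mem_nhdsWithin] with σ hσ hpos
  filter_upwards [hσ] with ω hω
  have hp : 0 < σ ^ 4 := pow_pos hpos 4
  rw [norm_div, Real.norm_of_nonneg hp.le, div_le_iff₀ hp, mul_comm (C * G ω)]
  exact hω

end IsSmallVolatilityFamily

end SmallVolatility

/-! ### Rescaled minimization and the general expansion -/

section Expansion

/-- The polynomial part of the rescaled expected excess at retention `q + c σ²`. -/
lemma tendsto_rescaled_excess {a b d e k m f₀ f₁ f₂ c : ℝ} {N₂ N₃ N₄ : ℝ → ℝ}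
    (h₂ : (fun σ => N₂ σ - (σ ^ 2 + b * σ ^ 3 + d * σ ^ 4)) =o[𝓝[>] 0] fun σ => σ ^ 4)
    (h₃ : (fun σ => N₃ σ - (e * σ ^ 3 + k * σ ^ 4)) =o[𝓝[>] 0] fun σ => σ ^ 4)
    (h₄ : (fun σ => N₄ σ - m * σ ^ 4) =o[𝓝[>] 0] fun σ => σ ^ 4) :
    Tendsto (fun σ => (f₀ / 2 * ((a + c * σ ^ 2) ^ 2 * N₂ σ) + f₀ / 2 * (c * σ ^ 2) ^ 2
      + f₁ / 6 * ((a + c * σ ^ 2) ^ 3 * N₃ σ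
        + 3 * (a + c * σ ^ 2) ^ 2 * (c * σ ^ 2) * N₂ σ + (c * σ ^ 2) ^ 3)
      + f₂ / 24 * ((a + c * σ ^ 2) ^ 4 * N₄ σ
        + 4 * (a + c * σ ^ 2) ^ 3 * (c * σ ^ 2) * N₃ σ
        + 6 * (a + c * σ ^ 2) ^ 2 * (c * σ ^ 2) ^ 2 * N₂ σ + (c * σ ^ 2) ^ 4)
      - (f₀ * a ^ 2 / 2 * σ ^ 2 + (f₀ * a ^ 2 * b / 2 + f₁ * a ^ 3 * e / 6) * σ ^ 3)) / σ ^ 4)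
      (𝓝[>] 0)
      (𝓝 (f₀ / 2 * (a ^ 2 * d + 2 * a * c + c ^ 2) + f₁ / 6 * (a ^ 3 * k + 3 * a ^ 2 * c)
        + f₂ / 24 * a ^ 4 * m)) := by
  have hσ : Tendsto (fun σ : ℝ => σ) (𝓝[>] 0) (𝓝 0) := nhdsWithin_le_nhds
  -- `G` is the quotient with the division by `σ⁴` carried out, as a polynomial in `σ` and the
  -- normalized moment errors; the limit is its value at the origin.
  set G : ℝ × ℝ × ℝ × ℝ → ℝ := fun ⟨σ, n₂, n₃, n₄⟩ =>
    f₀ / 2 * (a ^ 2 * (d + n₂) + (2 * a * c + c ^ 2 * σ ^ 2) * (1 + b * σ + (d + n₂) * σ ^ 2))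
    + f₀ / 2 * c ^ 2
    + f₁ / 6 * ((a + c * σ ^ 2) ^ 3 * (k + n₃)
      + σ * e * (3 * a ^ 2 * c + 3 * a * c ^ 2 * σ ^ 2 + c ^ 3 * σ ^ 4)
      + 3 * (a + c * σ ^ 2) ^ 2 * c * (1 + b * σ + (d + n₂) * σ ^ 2) + c ^ 3 * σ ^ 2)
    + f₂ / 24 * ((a + c * σ ^ 2) ^ 4 * (m + n₄)
      + 4 * (a + c * σ ^ 2) ^ 3 * c * σ * (e + (k + n₃) * σ)
      + 6 * (a + c * σ ^ 2) ^ 2 * c ^ 2 * σ ^ 2 * (1 + b * σ + (d + n₂) * σ ^ 2) + c ^ 4 * σ ^ 4)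
    with hG
  have hGc : Continuous G := by rw [hG]; fun_prop
  have hlim := (hGc.tendsto (0, 0, 0, 0)).comp (hσ.prodMk_nhds (h₂.tendsto_div_nhds_zero.prodMk_nhds
    (h₃.tendsto_div_nhds_zero.prodMk_nhds h₄.tendsto_div_nhds_zero)))
  have e0 : G (0, 0, 0, 0) = f₀ / 2 * (a ^ 2 * d + 2 * a * c + c ^ 2)
      + f₁ / 6 * (a ^ 3 * k + 3 * a ^ 2 * c) + f₂ / 24 * a ^ 4 * m := by
    simp only [hG]; ring
  rw [e0] at hlim
  refine hlim.congr' ?_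
  filter_upwards [self_mem_nhdsWithin] with σ hpos
  have hne : σ ≠ 0 := (show (0 : ℝ) < σ from hpos).ne'
  simp only [Function.comp_apply, hG]
  set n₂ := (N₂ σ - (σ ^ 2 + b * σ ^ 3 + d * σ ^ 4)) / σ ^ 4 with hn₂
  set n₃ := (N₃ σ - (e * σ ^ 3 + k * σ ^ 4)) / σ ^ 4 with hn₃
  set n₄ := (N₄ σ - m * σ ^ 4) / σ ^ 4 with hn₄
  have e₂ : N₂ σ = σ ^ 2 + b * σ ^ 3 + (d + n₂) * σ ^ 4 := by rw [hn₂]; field_simp; ring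
  have e₃ : N₃ σ = e * σ ^ 3 + (k + n₃) * σ ^ 4 := by rw [hn₃]; field_simp; ring
  have e₄ : N₄ σ = (m + n₄) * σ ^ 4 := by rw [hn₄]; field_simp; ring
  rw [eq_div_iff (pow_ne_zero 4 hne), e₂, e₃, e₄]
  ring

variable {Ω : Type*} [MeasurableSpace Ω] {P : Measure Ω} [IsProbabilityMeasure P]

lemma convexOn_excess {Z : Ω → ℝ} (hZ : Integrable Z P) :
    ConvexOn ℝ Set.univ fun m => ∫ ω, max (- Z ω - m) 0 ∂P := by
  have hint : ∀ m, Integrable (fun ω => max (- Z ω - m) 0) P := fun m =>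
    (hZ.neg.sub (integrable_const m)).pos_part
  refine ⟨convex_univ, fun x _ y _ s t hs ht hst => ?_⟩
  simp only [smul_eq_mul]
  rw [← integral_const_mul, ← integral_const_mul,
    ← integral_add ((hint x).const_mul s) ((hint y).const_mul t)]
  refine integral_mono (hint _) (((hint x).const_mul s).add ((hint y).const_mul t)) fun ω => ?_
  refine max_le ?_ (add_nonneg (mul_nonneg hs (le_max_right _ _)) (mul_nonneg ht (le_max_right _ _)))
  have h1 := mul_le_mul_of_nonneg_left (le_max_left (- Z ω - x) 0) hs
  have h2 := mul_le_mul_of_nonneg_left (le_max_left (- Z ω - y) 0) ht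
  have h3 : - Z ω = s * (- Z ω) + t * (- Z ω) := by rw [← add_mul, hst, one_mul]
  linarith

/-- Fourth order expansion of expected shortfall along a family of small volatility. -/
theorem IsSmallVolatilityFamily.expectedShortfall_isLittleO {W : ℝ → Ω → ℝ} {b d e k m : ℝ}
    (h : IsSmallVolatilityFamily P W b d e k m) {L : Ω → ℝ} (hL : Measurable L)
    (hWL : ∀ σ, IndepFun (W σ) L P) (hLint : Integrable L P)
    {f : ℝ → ℝ} (hf : Measurable f) (hfpos : ∀ y, 0 < f y)
    (hLf : P.map L = volume.withDensity fun y => ENNReal.ofReal (f y))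
    {α : ℝ} (hα : α ∈ Set.Ioo (0 : ℝ) 1) {q : ℝ} (hq : q = lawQuantile (P.map L) (1 - α))
    (hf1 : ∀ᶠ y in 𝓝 q, DifferentiableAt ℝ f y) (hf2 : DifferentiableAt ℝ (deriv f) q) (φ : ℝ) :
    (fun σ => expectedShortfall P α (surplus (W σ) L φ) -
      (expectedShortfall P α (fun ω => - L ω)
        + f q * (q - φ) ^ 2 / 2 * σ ^ 2 / α
        + (f q * (q - φ) ^ 2 * b / 2 + deriv f q * (q - φ) ^ 3 * e / 6) * σ ^ 3 / α
        + (f q * (q - φ) ^ 2 * d / 2 + deriv f q * (q - φ) ^ 3 * k / 6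
          + deriv (deriv f) q * (q - φ) ^ 4 * m / 24
          - (f q * (q - φ) + deriv f q * (q - φ) ^ 2 / 2) ^ 2 / (2 * f q)) * σ ^ 4 / α))
      =o[𝓝[>] 0] fun σ => σ ^ 4 := by
  have hPL : IsProbabilityMeasure (P.map L) := Measure.isProbabilityMeasure_map hL.aemeasurable
  have hna : NullSingletonClass (P.map L) := by rw [hLf]; infer_instance
  have hid : Integrable (fun x : ℝ => x) (P.map L) :=
    (integrable_map_measure aestronglyMeasurable_id hL.aemeasurable).2 hLint
  have hcdf : cdf (P.map L) q = 1 - α := by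
    have hc : ContinuousAt (cdf (P.map L)) q :=
      (hasDerivAt_cdf hf hfpos hLf hf1.self_of_nhds.continuousAt).continuousAt
    rw [hq] at hc ⊢
    exact cdf_lawQuantile ⟨by linarith [hα.2], by linarith [hα.1]⟩ hc
  have ho := stopLossRemainder_isLittleO hid hf hfpos hLf hcdf hf1 hf2
  obtain ⟨C, hC⟩ := exists_abs_stopLossRemainder_le hid ho
  have hslm : Measurable (stopLoss (P.map L)) :=
    (continuous_iff_continuousAt.2 fun x => (hasDerivAt_stopLoss hid x).continuousAt).measurable
  have hrm : Measurable
      (stopLossRemainder (P.map L) q α (f q) (deriv f q) (deriv (deriv f) q)) := by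
    unfold stopLossRemainder
    fun_prop
  set R := stopLossRemainder (P.map L) q α (f q) (deriv f q) (deriv (deriv f) q)
  have hES0 : α * expectedShortfall P α (fun ω => - L ω) = α * q + stopLoss (P.map L) q := by
    have hZ := mul_expectedShortfall_eq (P := P) (Z := fun ω => - L ω) (q := q) hL.neg hLint.neg hα
      (by simpa using hq)
    rw [hZ, stopLoss_map hL]
    simp
  set a := q - φ with ha
  set f₀ := f q
  set f₁ := deriv f q
  set f₂ := deriv (deriv f) q
  have hf₀ : 0 < f₀ := hfpos q
  set s₂ := f₀ * a ^ 2 / 2 with hs₂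
  set s₃ := f₀ * a ^ 2 * b / 2 + f₁ * a ^ 3 * e / 6 with hs₃
  have hZm : ∀ σ, Measurable (surplus (W σ) L φ) := fun σ => by
    have := h.measurable σ
    unfold surplus
    fun_prop
  have hZint : ∀ᶠ σ in 𝓝[>] 0, Integrable (surplus (W σ) L φ) P := by
    filter_upwards [h.integrable] with σ hσ
    exact ((hσ.sub (integrable_const 1)).const_mul φ).sub ((hWL σ).integrable_mul hσ hLint)
  -- The objective at retention `q + c σ²`, rescaled so that `c` first matters in the limit at order
  -- `σ⁴`.
  set K : ℝ → ℝ → ℝ := fun σ c =>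
    (α * (q + c * σ ^ 2) + (∫ ω, max (- surplus (W σ) L φ ω - (q + c * σ ^ 2)) 0 ∂P)
      - (α * q + stopLoss (P.map L) q) - (s₂ * σ ^ 2 + s₃ * σ ^ 3)) / σ ^ 4 with hK
  set s₄ := f₀ * a ^ 2 * d / 2 + f₁ * a ^ 3 * k / 6 + f₂ * a ^ 4 * m / 24
    - (f₀ * a + f₁ * a ^ 2 / 2) ^ 2 / (2 * f₀) with hs₄
  -- The limit is quadratic in `c` with leading coefficient `f₀ / 2`; completing the square gives
  -- the subtracted quotient in `s₄`.
  have hKlim : ∀ c, Tendsto (fun σ => K σ c) (𝓝[>] 0)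
      (𝓝 (s₄ + f₀ / 2 * (c - -(f₀ * a + f₁ * a ^ 2 / 2) / f₀) ^ 2)) := by
    intro c
    obtain ⟨hrint, hrlim⟩ := h.integral_remainder_isLittleO hrm ho hC a c
    have hlim := (tendsto_rescaled_excess (a := a) (f₀ := f₀) (f₁ := f₁) (f₂ := f₂) (c := c)
      h.moment_two h.moment_three h.moment_four).add hrlim
    have e0 : s₄ + f₀ / 2 * (c - -(f₀ * a + f₁ * a ^ 2 / 2) / f₀) ^ 2 =
        f₀ / 2 * (a ^ 2 * d + 2 * a * c + c ^ 2) + f₁ / 6 * (a ^ 3 * k + 3 * a ^ 2 * c)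
        + f₂ / 24 * a ^ 4 * m + 0 := by
      rw [hs₄]; field_simp; ring
    rw [e0]
    refine hlim.congr' ?_
    filter_upwards [h.ae_pos, h.integrable, h.integral_eq, h.integrable_four, hrint] with
      σ hpos hint hone h4 hr
    have eA : q + c * σ ^ 2 - φ = a + c * σ ^ 2 := by rw [ha]; ring
    have key := integral_mul_stopLoss_eq (h.measurable σ) hpos hint hone h4
      (ν := P.map L) (q := q) (α := α) (f₀ := f₀) (f₁ := f₁) (f₂ := f₂) φ (c * σ ^ 2)
      (by rw [eA]; exact hr)
    rw [← integral_posPart_eq_integral_mul_stopLoss (h.measurable σ) hL (hWL σ) hpos hint hLint,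
      eA] at key
    simp only [hK]
    rw [key, ← add_div]
    congr 1
    rw [hs₂, hs₃]
    ring
  have hlim : Tendsto (fun σ => (α * expectedShortfall P α (surplus (W σ) L φ)
      - (α * q + stopLoss (P.map L) q) - (s₂ * σ ^ 2 + s₃ * σ ^ 3)) / σ ^ 4) (𝓝[>] 0) (𝓝 s₄) := by
    refine tendsto_min_of_convexOn (half_pos hf₀) ?_ hKlim ?_ ?_
    · filter_upwards [hZint, self_mem_nhdsWithin] with σ hσ hpos
      have hcv := convexOn_excess hσ
      refine ⟨convex_univ, fun x _ y _ s t hs ht hst => ?_⟩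
      have h1 := hcv.2 (Set.mem_univ (q + x * σ ^ 2)) (Set.mem_univ (q + y * σ ^ 2)) hs ht hst
      have e1 : s • (q + x * σ ^ 2) + t • (q + y * σ ^ 2) = q + (s • x + t • y) * σ ^ 2 := by
        simp only [smul_eq_mul]
        linear_combination q * hst
      rw [e1] at h1
      simp only [hK, smul_eq_mul] at h1 ⊢
      have hp : 0 < σ ^ 4 := pow_pos hpos 4
      rw [← mul_div_assoc, ← mul_div_assoc, ← add_div]
      refine div_le_div_of_nonneg_right ?_ hp.le
      have ht' : t = 1 - s := by linarith
      subst ht'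
      linarith
    · filter_upwards [hZint, self_mem_nhdsWithin] with σ hσ hpos c
      refine div_le_div_of_nonneg_right ?_ (pow_pos hpos 4).le
      linarith [mul_expectedShortfall_le (hZm σ) hσ hα (q + c * σ ^ 2)]
    · filter_upwards [hZint, self_mem_nhdsWithin] with σ hσ hpos
      have hne : σ ≠ 0 := (show (0 : ℝ) < σ from hpos).ne'
      -- The minimizing retention, the quantile of the loss, in the rescaled variable.
      refine ⟨(lawQuantile (P.map fun ω => - surplus (W σ) L φ ω) (1 - α) - q) / σ ^ 2, ?_⟩
      simp only [hK]
      rw [div_mul_cancel₀ _ (pow_ne_zero 2 hne), add_sub_cancel,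
        ← mul_expectedShortfall_eq (hZm σ) hσ hα rfl]
  rw [isLittleO_iff_tendsto' (by
    filter_upwards [self_mem_nhdsWithin] with σ hpos h0
    exact absurd h0 (pow_pos hpos 4).ne')]
  have hfin := (hlim.sub_const s₄).div_const α
  rw [sub_self, zero_div] at hfin
  refine hfin.congr' ?_
  filter_upwards [self_mem_nhdsWithin] with σ hpos
  have hne : σ ≠ 0 := (show (0 : ℝ) < σ from hpos).ne'
  have hα0 : α ≠ 0 := hα.1.ne'
  rw [← hES0]
  field_simp
  ring

end Expansion

/-! ### Standardized random variables -/

section Standardized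

variable {Ω : Type*} [MeasurableSpace Ω] {P : Measure Ω}

lemma measurable_standardized {Z : Ω → ℝ} (hZ : Measurable Z) : Measurable (standardized P Z) := by
  unfold standardized
  fun_prop

lemma integral_standardized_sq {Z : Ω → ℝ} (hZ : Measurable Z) (hv : 0 < variance Z P) :
    ∫ ω, standardized P Z ω ^ 2 ∂P = 1 := by
  simp only [standardized, div_pow]
  rw [integral_div, Real.sq_sqrt hv.le, ← variance_eq_integral hZ.aemeasurable, div_self hv.ne']

variable [IsProbabilityMeasure P]

/-- Without square integrability `evariance` is infinite and `variance` takes the default value 0,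
so positivity excludes that case. -/
lemma memLp_two_of_variance_pos {Z : Ω → ℝ} (hZ : Measurable Z) (hv : 0 < variance Z P) :
    MemLp Z 2 P := by
  by_contra h
  rw [variance, evariance_eq_top hZ.aestronglyMeasurable h] at hv
  simp at hv

lemma integral_standardized {Z : Ω → ℝ} (hZ : Integrable Z P) :
    ∫ ω, standardized P Z ω ∂P = 0 := by
  unfold standardized
  rw [integral_div, integral_sub hZ (integrable_const _)]
  simp

lemma memLp_standardized {Z : Ω → ℝ} {p : ENNReal} (hZ : MemLp Z p P) :
    MemLp (standardized P Z) p P := by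
  have h := (hZ.sub (memLp_const (∫ ω, Z ω ∂P))).const_mul (√(variance Z P))⁻¹
  refine h.ae_eq (Eventually.of_forall fun ω => ?_)
  simp [standardized, div_eq_inv_mul]

end Standardized

/-! ### Moments in the normal volatility -/

section Normal

variable {Ω : Type*} [MeasurableSpace Ω] {P : Measure Ω}

/-- The lower bound on `Y` keeps `σ Y > -1/2` once `σ < s / 2`. There `r` is bounded, so `C Y⁴`
dominates and four moments of `Y` suffice. -/
lemma isLittleO_integral_of_expansion {Y : Ω → ℝ} (hY : Measurable Y)
    (hi : ∀ n ≤ 4, Integrable (fun ω => Y ω ^ n) P) {T r : ℝ → ℝ} (hr : Measurable r)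
    (hr0 : Tendsto r (𝓝 0) (𝓝 0)) {C s c₂ c₃ c₄ : ℝ} (hs : 0 < s) (hsY : ∀ᵐ ω ∂P, - s⁻¹ < Y ω)
    (hrC : ∀ x, -(1 / 2) < x → |r x| ≤ C)
    (hT : ∀ x, -(1 / 2) < x → T x = c₂ * x ^ 2 + c₃ * x ^ 3 + c₄ * x ^ 4 + x ^ 4 * r x) :
    (fun σ => (∫ ω, T (σ * Y ω) ∂P) - (c₂ * (∫ ω, Y ω ^ 2 ∂P) * σ ^ 2
      + c₃ * (∫ ω, Y ω ^ 3 ∂P) * σ ^ 3 + c₄ * (∫ ω, Y ω ^ 4 ∂P) * σ ^ 4))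
      =o[𝓝[>] 0] fun σ => σ ^ 4 := by
  have hlow : ∀ᶠ σ in 𝓝[>] (0 : ℝ), ∀ᵐ ω ∂P, -(1 / 2) < σ * Y ω := by
    filter_upwards [Ioo_mem_nhdsGT (half_pos hs)] with σ hσ
    filter_upwards [hsY] with ω hω
    have h1 : σ * s⁻¹ < 1 / 2 := by rw [← div_eq_mul_inv, div_lt_iff₀ hs]; linarith [hσ.2]
    nlinarith [mul_lt_mul_of_pos_left hω hσ.1]
  have hdct : Tendsto (fun σ => ∫ ω, Y ω ^ 4 * r (σ * Y ω) ∂P) (𝓝[>] 0) (𝓝 (∫ _, (0 : ℝ) ∂P)) := by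
    refine tendsto_integral_filter_of_dominated_convergence (fun ω => C * Y ω ^ 4)
      (Eventually.of_forall fun σ => ?_) ?_ ((hi 4 le_rfl).const_mul C)
      (Eventually.of_forall fun ω => ?_)
    · exact ((hY.pow_const 4).mul (hr.comp (hY.const_mul σ))).aestronglyMeasurable
    · filter_upwards [hlow] with σ hσ
      filter_upwards [hσ] with ω hω
      rw [norm_mul, Real.norm_of_nonneg (by positivity : 0 ≤ Y ω ^ 4), mul_comm]
      exact mul_le_mul_of_nonneg_right (hrC _ hω) (by positivity)
    · have : Tendsto (fun σ => σ * Y ω) (𝓝[>] 0) (𝓝 0) := by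
        have h := ((continuous_mul_const (Y ω)).tendsto (0 : ℝ)).mono_left
          (nhdsWithin_le_nhds (s := Set.Ioi 0))
        simpa using h
      simpa using (hr0.comp this).const_mul (Y ω ^ 4)
  rw [integral_zero] at hdct
  have hint : ∀ᶠ σ in 𝓝[>] (0 : ℝ), Integrable (fun ω => Y ω ^ 4 * r (σ * Y ω)) P := by
    filter_upwards [hlow] with σ hσ
    refine ((hi 4 le_rfl).const_mul C).mono'
      ((hY.pow_const 4).mul (hr.comp (hY.const_mul σ))).aestronglyMeasurable ?_
    filter_upwards [hσ] with ω hω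
    rw [norm_mul, Real.norm_of_nonneg (by positivity : 0 ≤ Y ω ^ 4), mul_comm]
    exact mul_le_mul_of_nonneg_right (hrC _ hω) (by positivity)
  rw [isLittleO_iff_tendsto' (by
    filter_upwards [self_mem_nhdsWithin] with σ hpos h0
    exact absurd h0 (pow_pos hpos 4).ne')]
  refine hdct.congr' ?_
  filter_upwards [self_mem_nhdsWithin, hlow, hint] with σ hpos hσ hR
  rw [eq_div_iff (pow_pos hpos 4).ne']
  have e : ∀ᵐ ω ∂P, T (σ * Y ω) = c₂ * σ ^ 2 * Y ω ^ 2 + c₃ * σ ^ 3 * Y ω ^ 3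
      + c₄ * σ ^ 4 * Y ω ^ 4 + σ ^ 4 * (Y ω ^ 4 * r (σ * Y ω)) := by
    filter_upwards [hσ] with ω hω
    rw [hT _ hω]
    ring
  have i2 := (hi 2 (by norm_num)).const_mul (c₂ * σ ^ 2)
  have i3 := (hi 3 (by norm_num)).const_mul (c₃ * σ ^ 3)
  have i4 := (hi 4 le_rfl).const_mul (c₄ * σ ^ 4)
  have i23 : Integrable (fun ω => c₂ * σ ^ 2 * Y ω ^ 2 + c₃ * σ ^ 3 * Y ω ^ 3) P := i2.add i3
  have i234 : Integrable (fun ω => c₂ * σ ^ 2 * Y ω ^ 2 + c₃ * σ ^ 3 * Y ω ^ 3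
    + c₄ * σ ^ 4 * Y ω ^ 4) P := i23.add i4
  rw [integral_congr_ae e, integral_add i234 (hR.const_mul _), integral_add i23 i4,
    integral_add i2 i3]
  simp only [integral_const_mul]
  ring

/-- Positivity of `X` gives `Y > -1/√Var`. With `x = σ Y` the integrands are `(-x)^k / (1 +
x)^(k-1)`, expanded with explicit rational remainders. -/
lemma isSmallVolatilityFamily_normalAsset [IsProbabilityMeasure P] {X : Ω → ℝ}
    (hX : Measurable X) (hXpos : ∀ᵐ ω ∂P, 0 < X ω) (hEX : ∫ ω, X ω ∂P = 1)
    (hv : 0 < variance X P) (hX4 : MemLp X 4 P) :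
    IsSmallVolatilityFamily P (normalAsset P X) (-stdMoment P X 3) (stdMoment P X 4)
      (-stdMoment P X 3) (2 * stdMoment P X 4) (stdMoment P X 4) := by
  set Y := standardized P X with hYdef
  have hY : Measurable Y := measurable_standardized hX
  have hs : 0 < √(variance X P) := Real.sqrt_pos.2 hv
  set s := √(variance X P)
  have hsY : ∀ᵐ ω ∂P, - s⁻¹ < Y ω := by
    filter_upwards [hXpos] with ω hω
    rw [hYdef, standardized, hEX, lt_div_iff₀ hs, neg_mul, inv_mul_cancel₀ hs.ne']
    linarith
  have hY4 : MemLp Y 4 P := memLp_standardized hX4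
  have hi : ∀ n ≤ 4, Integrable (fun ω => Y ω ^ n) P := fun n hn => by
    have h : MemLp Y (n : ENNReal) P := hY4.mono_exponent (by exact_mod_cast hn)
    refine (h.integrable_norm_pow' ).mono' (hY.pow_const n).aestronglyMeasurable ?_
    exact Eventually.of_forall fun ω => by rw [norm_pow]
  have hY1 : Integrable Y P := by simpa using hi 1 (by norm_num)
  have hEY : ∫ ω, Y ω ∂P = 0 := integral_standardized (hX4.integrable (by norm_num))
  have hEY2 : ∫ ω, Y ω ^ 2 ∂P = 1 := integral_standardized_sq hX hv
  have ht : Tendsto (fun x : ℝ => 1 + x) (𝓝 0) (𝓝 1) := by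
    simpa using (continuous_const_add (1 : ℝ)).tendsto 0
  have hx : Tendsto (fun x : ℝ => x) (𝓝 0) (𝓝 0) := tendsto_id
  have hr2 : Tendsto (fun x : ℝ => -x / (1 + x)) (𝓝 0) (𝓝 (-0 / 1)) := hx.neg.div ht one_ne_zero
  have hr3 : Tendsto (fun x : ℝ => (-3 * x - 2 * x ^ 2) / (1 + x) ^ 2) (𝓝 0)
      (𝓝 ((-3 * 0 - 2 * 0 ^ 2) / 1 ^ 2)) :=
    ((hx.const_mul (-3)).sub ((hx.pow 2).const_mul 2)).div (ht.pow 2) (by norm_num)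
  have exp2 := isLittleO_integral_of_expansion (P := P) hY hi
    (T := fun x => (1 + x) * ((1 + x)⁻¹ - 1) ^ 2) (r := fun x => -x / (1 + x)) (C := 1)
    (c₂ := 1) (c₃ := -1) (c₄ := 1) (by fun_prop) (by simpa using hr2) hs hsY
    (fun x hx => by
      have : 0 < 1 + x := by linarith
      rw [abs_div, abs_neg, abs_of_pos this, div_le_one this, abs_le]
      constructor <;> linarith)
    (fun x hx => by
      have : 1 + x ≠ 0 := by linarith
      field_simp
      ring)
  have exp3 := isLittleO_integral_of_expansion (P := P) hY hi
    (T := fun x => (1 + x) * ((1 + x)⁻¹ - 1) ^ 3)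
    (r := fun x => (-3 * x - 2 * x ^ 2) / (1 + x) ^ 2) (C := 8)
    (c₂ := 0) (c₃ := -1) (c₄ := 2) (by fun_prop)
    (by simpa using hr3)
    hs hsY
    (fun x hx => by
      have : 0 < 1 + x := by linarith
      rw [abs_div, abs_of_pos (pow_pos this 2), div_le_iff₀ (pow_pos this 2), abs_le]
      constructor <;> nlinarith [sq_nonneg (x + 1 / 2), sq_nonneg x])
    (fun x hx => by
      have : 1 + x ≠ 0 := by linarith
      field_simp
      ring)
  have exp4 := isLittleO_integral_of_expansion (P := P) hY hi
    (T := fun x => (1 + x) * ((1 + x)⁻¹ - 1) ^ 4)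
    (r := fun x => ((1 + x) ^ 3)⁻¹ - 1) (C := 8)
    (c₂ := 0) (c₃ := 0) (c₄ := 1) (by fun_prop)
    (by simpa using ((ht.pow 3).inv₀ (by norm_num)).sub_const 1)
    hs hsY
    (fun x hx => by
      have h1 : (1 / 2) ^ 3 ≤ (1 + x) ^ 3 := pow_le_pow_left₀ (by norm_num) (by linarith) 3
      have h2 : ((1 + x) ^ 3)⁻¹ ≤ ((1 / 2) ^ 3)⁻¹ := inv_anti₀ (by norm_num) h1
      have h3 : 0 < ((1 + x) ^ 3)⁻¹ := inv_pos.2 (by linarith)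
      norm_num at h2
      rw [abs_le]
      constructor <;> linarith)
    (fun x hx => by
      have : 1 + x ≠ 0 := by linarith
      field_simp
      ring)
  refine ⟨fun σ => (hY.const_mul σ).const_add 1,
    Eventually.of_forall fun σ => (integrable_const 1).add (hY1.const_mul σ),
    Eventually.of_forall fun σ => ?_,
    -- For `σ < s / 2` one has `W > 1/2`, and `W (W⁻¹ - 1)⁴ = (σ Y)⁴ / W³`; the 8 is `(1/2)⁻³`.
    ⟨fun ω => 8 * Y ω ^ 4, (hi 4 le_rfl).const_mul 8, s / 2, half_pos hs, ?_⟩,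
    Eventually.of_forall fun ω => ?_, ?_, ?_, ?_⟩
  · simp only [normalAsset]
    rw [integral_add (integrable_const 1) (hY1.const_mul σ), integral_const_mul, hEY]
    simp
  · filter_upwards [hsY] with ω hω σ hσ
    have h1 : σ * s⁻¹ < 1 / 2 := by rw [← div_eq_mul_inv, div_lt_iff₀ hs]; linarith [hσ.2]
    have h2 : 1 / 2 < 1 + σ * Y ω := by nlinarith [mul_lt_mul_of_pos_left hω hσ.1]
    have hw : normalAsset P X σ ω = 1 + σ * Y ω := rfl
    rw [hw]
    set w := 1 + σ * Y ω with hwdef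
    have hw0 : 0 < w := by linarith
    refine ⟨hw0, ?_⟩
    have e : w * (w⁻¹ - 1) ^ 4 = (σ * Y ω) ^ 4 / w ^ 3 := by
      have : σ * Y ω = w - 1 := by rw [hwdef]; ring
      rw [this]
      field_simp
      ring
    have h3 : (1 / 2) ^ 3 ≤ w ^ 3 := pow_le_pow_left₀ (by norm_num) h2.le 3
    rw [e, div_le_iff₀ (pow_pos hw0 3)]
    have h4 : 0 ≤ σ ^ 4 * Y ω ^ 4 := by positivity
    rw [mul_pow]
    nlinarith
  · have h := ((continuous_mul_const (Y ω)).tendsto (0 : ℝ)).mono_left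
      (nhdsWithin_le_nhds (s := Set.Ioi 0))
    simpa [normalAsset] using h.const_add 1
  · refine exp2.congr_left fun σ => ?_
    simp only [normalAsset, stdMoment, hEY2, ← hYdef]
    ring
  · refine exp3.congr_left fun σ => ?_
    simp only [normalAsset, stdMoment, ← hYdef]
    ring
  · refine exp4.congr_left fun σ => ?_
    simp only [normalAsset, stdMoment, ← hYdef]
    ring

end Normal

/-! ### Moments in the log-normal volatility -/

section LogNormal

/-- Moment expansions obtained from the Taylor polynomial of a moment generating function. -/
lemma isLittleO_of_mgf_expansion {M : ℝ → ℝ} {u v : ℝ}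
    (hM : (fun σ => M σ - (1 + σ ^ 2 / 2 + u * σ ^ 3 + v * σ ^ 4)) =o[𝓝 0] fun σ => σ ^ 4) :
    ((fun σ => (M (-σ) * M σ - 1) - (σ ^ 2 + 0 * σ ^ 3 + (1 / 4 + 2 * v) * σ ^ 4))
      =o[𝓝[>] 0] fun σ => σ ^ 4) ∧
    ((fun σ => (M (-(2 * σ)) * M σ ^ 2 - 3 * M (-σ) * M σ + 2)
      - (-6 * u * σ ^ 3 + (3 / 2 + 12 * v) * σ ^ 4)) =o[𝓝[>] 0] fun σ => σ ^ 4) ∧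
    ((fun σ => (M (-(3 * σ)) * M σ ^ 3 - 4 * M (-(2 * σ)) * M σ ^ 2 + 6 * M (-σ) * M σ - 3)
      - 24 * v * σ ^ 4) =o[𝓝[>] 0] fun σ => σ ^ 4) := by
  have hσ : Tendsto (fun σ : ℝ => σ) (𝓝[>] 0) (𝓝 0) := nhdsWithin_le_nhds
  -- Factoring out `σ²` makes the quotients below exact algebraic combinations of the vanishing
  -- errors and of brackets tending to `j² / 2`.
  have scaled : ∀ j : ℝ, ∃ E : ℝ → ℝ, Tendsto E (𝓝[>] 0) (𝓝 0) ∧ ∀ᶠ σ in 𝓝[>] 0,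
      M (j * σ) = 1 + σ ^ 2 * (j ^ 2 / 2 + j ^ 3 * u * σ + (j ^ 4 * v + E σ) * σ ^ 2) := by
    intro j
    have hj : Tendsto (fun σ : ℝ => j * σ) (𝓝[>] 0) (𝓝 0) := by simpa using hσ.const_mul j
    have ho : (fun σ => M (j * σ) - (1 + (j * σ) ^ 2 / 2 + u * (j * σ) ^ 3 + v * (j * σ) ^ 4))
        =o[𝓝[>] 0] fun σ => σ ^ 4 := by
      refine (hM.comp_tendsto hj).trans_isBigO ?_
      refine IsBigO.of_bound (|j| ^ 4) (Eventually.of_forall fun σ => ?_)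
      simp [mul_pow]
    refine ⟨_, ho.tendsto_div_nhds_zero, ?_⟩
    filter_upwards [self_mem_nhdsWithin] with σ hpos
    have hne : σ ≠ 0 := (show (0 : ℝ) < σ from hpos).ne'
    field_simp
    ring
  obtain ⟨E₁, hE₁, h₁⟩ := scaled 1
  obtain ⟨F₁, hF₁, k₁⟩ := scaled (-1)
  obtain ⟨F₂, hF₂, k₂⟩ := scaled (-2)
  obtain ⟨F₃, hF₃, k₃⟩ := scaled (-3)
  have glim : ∀ (j : ℝ) {E : ℝ → ℝ}, Tendsto E (𝓝[>] 0) (𝓝 0) →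
      Tendsto (fun σ => j ^ 2 / 2 + j ^ 3 * u * σ + (j ^ 4 * v + E σ) * σ ^ 2) (𝓝[>] 0)
        (𝓝 (j ^ 2 / 2)) := by
    intro j E hE
    simpa using ((hσ.const_mul (j ^ 3 * u)).const_add (j ^ 2 / 2)).add
      ((hE.const_add (j ^ 4 * v)).mul (hσ.pow 2))
  have g₁ := glim 1 hE₁
  have l₁ := glim (-1) hF₁
  have l₂ := glim (-2) hF₂
  have l₃ := glim (-3) hF₃
  have hzero : ∀ᶠ σ in 𝓝[>] (0 : ℝ), σ ^ 4 = 0 → False := by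
    filter_upwards [self_mem_nhdsWithin] with σ hpos h0
    exact (pow_pos hpos 4).ne' h0
  refine ⟨?_, ?_, ?_⟩
  · rw [isLittleO_iff_tendsto' (hzero.mono fun σ h h0 => (h h0).elim)]
    have lim := ((hE₁.add hF₁).add (l₁.mul g₁)).sub_const (1 / 4)
    norm_num at lim
    refine lim.congr' ?_
    filter_upwards [self_mem_nhdsWithin, h₁, k₁] with σ hpos e₁ d₁
    rw [eq_div_iff (pow_pos hpos 4).ne']
    rw [one_mul] at e₁
    rw [neg_one_mul] at d₁
    rw [e₁, d₁]
    ring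
  · rw [isLittleO_iff_tendsto' (hzero.mono fun σ h h0 => (h h0).elim)]
    have lim := ((((hF₂.sub hE₁).sub (hF₁.const_mul 3)).add
      (((g₁.pow 2).add ((l₂.const_mul 2).mul g₁)).sub ((l₁.const_mul 3).mul g₁))).sub_const
        (3 / 2)).add ((hσ.pow 2).mul (l₂.mul (g₁.pow 2)))
    norm_num at lim
    refine lim.congr' ?_
    filter_upwards [self_mem_nhdsWithin, h₁, k₁, k₂] with σ hpos e₁ d₁ d₂
    rw [eq_div_iff (pow_pos hpos 4).ne']
    rw [one_mul] at e₁
    rw [neg_one_mul] at d₁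
    rw [neg_mul] at d₂
    rw [e₁, d₁, d₂]
    ring
  · rw [isLittleO_iff_tendsto' (hzero.mono fun σ h h0 => (h h0).elim)]
    have lim := (((((hF₃.sub (hF₂.const_mul 4)).add (hF₁.const_mul 6)).add hE₁).add
      (((((g₁.pow 2).const_mul (-1)).add ((l₃.const_mul 3).mul g₁)).sub
        ((l₂.const_mul 8).mul g₁)).add ((l₁.const_mul 6).mul g₁))).add
      ((hσ.pow 2).mul (((g₁.pow 3).add ((l₃.const_mul 3).mul (g₁.pow 2))).sub
        ((l₂.const_mul 4).mul (g₁.pow 2))))).add ((hσ.pow 4).mul (l₃.mul (g₁.pow 3)))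
    norm_num at lim
    refine lim.congr' ?_
    filter_upwards [self_mem_nhdsWithin, h₁, k₁, k₂, k₃] with σ hpos e₁ d₁ d₂ d₃
    rw [eq_div_iff (pow_pos hpos 4).ne']
    rw [one_mul] at e₁
    rw [neg_one_mul] at d₁
    rw [neg_mul] at d₂ d₃
    rw [e₁, d₁, d₂, d₃]
    ring

lemma abs_exp_sub_one_le_mul_exp (z : ℝ) : |Real.exp z - 1| ≤ |z| * Real.exp |z| := by
  have h1 := Real.add_one_le_exp z
  rcases le_total 0 z with hz | hz
  · rw [abs_of_nonneg hz, abs_of_nonneg (by linarith)]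
    have h2 := Real.add_one_le_exp (-z)
    have h3 : Real.exp z * Real.exp (-z) = 1 := by rw [← Real.exp_add]; simp
    nlinarith [Real.exp_pos z]
  · have h2 : Real.exp z ≤ 1 := Real.exp_le_one_iff.2 hz
    rw [abs_of_nonpos (by linarith), abs_of_nonpos hz]
    have h3 : 1 ≤ Real.exp (-z) := Real.one_le_exp (by linarith)
    nlinarith

/-- Pointwise domination for the exponential family `exp (σ y) / M`. -/
lemma exp_div_mul_pow_four_le {y M σ s : ℝ} (hs : 0 < s) (hσ : 0 < σ) (hσs : σ ≤ s / 10)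
    (hM : |M - 1| ≤ σ) (hM1 : 1 / 2 ≤ M) (hM2 : M ≤ 2) :
    Real.exp (σ * y) / M * ((Real.exp (σ * y) / M)⁻¹ - 1) ^ 4 ≤
      σ ^ 4 * (2 * (1 + 20 / s) ^ 4 * Real.exp (s * |y|)) := by
  have hMpos : 0 < M := by linarith
  set t := |y| with ht
  have ht0 : 0 ≤ t := abs_nonneg y
  have hW : Real.exp (σ * y) / M ≤ 2 * Real.exp (σ * t) := by
    rw [div_le_iff₀ hMpos]
    have h1 : Real.exp (σ * y) ≤ Real.exp (σ * t) := by
      gcongr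
      exact le_abs_self y
    nlinarith [Real.exp_pos (σ * t)]
  have hD : |(Real.exp (σ * y) / M)⁻¹ - 1| ≤ σ * (2 * t + 1) * Real.exp (σ * t) := by
    have e : (Real.exp (σ * y) / M)⁻¹ - 1 = M * (Real.exp (-(σ * y)) - 1) + (M - 1) := by
      rw [inv_div, Real.exp_neg]; ring
    have h1 := abs_exp_sub_one_le_mul_exp (-(σ * y))
    rw [abs_neg, abs_mul, abs_of_pos hσ, ← ht] at h1
    have h2 : 1 ≤ Real.exp (σ * t) := Real.one_le_exp (by positivity)
    calc |(Real.exp (σ * y) / M)⁻¹ - 1| ≤ |M * (Real.exp (-(σ * y)) - 1)| + |M - 1| := by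
          rw [e]; exact abs_add_le _ _
      _ ≤ 2 * (σ * t * Real.exp (σ * t)) + σ * Real.exp (σ * t) := by
          rw [abs_mul, abs_of_pos hMpos]
          gcongr
          exact hM.trans (le_mul_of_one_le_right hσ.le h2)
      _ = _ := by ring
  -- The linear factor is absorbed into an exponential through `2 t = (20 / s)(s t / 10)`.
  have hlin : 2 * t + 1 ≤ (1 + 20 / s) * Real.exp (s / 10 * t) := by
    have h1 := Real.add_one_le_exp (s / 10 * t)
    have h2 : 1 ≤ Real.exp (s / 10 * t) := Real.one_le_exp (by positivity)
    have h3 : 2 * t = 20 / s * (s / 10 * t) := by field_simp; ring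
    have h4 : 20 / s * (s / 10 * t) ≤ 20 / s * Real.exp (s / 10 * t) := by
      gcongr
      linarith
    linarith
  have hexp : Real.exp (σ * t) ≤ Real.exp (s / 10 * t) := by gcongr
  -- Nine factors `exp (s t / 10)` arise: one from `W`, four from `exp (σ t)`, four from the linear
  -- factor. Since `9 / 10 ≤ 1` they fit under `exp (s t)`.
  calc Real.exp (σ * y) / M * ((Real.exp (σ * y) / M)⁻¹ - 1) ^ 4
      = Real.exp (σ * y) / M * |(Real.exp (σ * y) / M)⁻¹ - 1| ^ 4 := by
        rw [← abs_pow, abs_of_nonneg (by positivity : 0 ≤ ((Real.exp (σ * y) / M)⁻¹ - 1) ^ 4)]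
    _ ≤ 2 * Real.exp (s / 10 * t) *
        (σ * ((1 + 20 / s) * Real.exp (s / 10 * t)) * Real.exp (s / 10 * t)) ^ 4 := by
        refine mul_le_mul (hW.trans (by gcongr)) (pow_le_pow_left₀ (abs_nonneg _)
          (hD.trans (by gcongr)) 4) (by positivity) (by positivity)
    _ = σ ^ 4 * (2 * (1 + 20 / s) ^ 4 * Real.exp (s / 10 * t) ^ 9) := by ring
    _ ≤ _ := by
        rw [← Real.exp_nat_mul]
        refine mul_le_mul_of_nonneg_left (mul_le_mul_of_nonneg_left (Real.exp_le_exp.2 ?_)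
          (by positivity)) (by positivity)
        push_cast
        nlinarith [mul_nonneg hs.le ht0]

variable {Ω : Type*} [MeasurableSpace Ω] {P : Measure Ω} [IsProbabilityMeasure P]

lemma mgf_expansion {Y : Ω → ℝ} (h0 : 0 ∈ interior (integrableExpSet Y P))
    (hEY : ∫ ω, Y ω ∂P = 0) (hEY2 : ∫ ω, Y ω ^ 2 ∂P = 1) :
    (fun σ => mgf Y P σ - (1 + σ ^ 2 / 2 + (∫ ω, Y ω ^ 3 ∂P) / 6 * σ ^ 3
      + (∫ ω, Y ω ^ 4 ∂P) / 24 * σ ^ 4)) =o[𝓝 0] fun σ => σ ^ 4 := by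
  -- The partial sum of length 5 has degree 4, leaving an error `O(σ⁵)`.
  have h := (hasFPowerSeriesAt_mgf h0).isBigO_sub_partialSum_pow 5
  have h5 : (fun y : ℝ => ‖y‖ ^ 5) =o[𝓝 0] fun y : ℝ => y ^ 4 := by
    have := (isLittleO_pow_pow (𝕜 := ℝ) (by norm_num : 4 < 5)).norm_left
    simpa [norm_pow] using this
  refine (h.trans_isLittleO h5).congr_left fun σ => ?_
  simp only [FormalMultilinearSeries.partialSum, FormalMultilinearSeries.ofScalars_apply_eq,
    Finset.sum_range_succ, Finset.sum_range_zero, zero_mul, Real.exp_zero, mul_one, zero_add,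
    pow_zero, pow_one, integral_const, probReal_univ, smul_eq_mul, hEY, hEY2, Nat.factorial]
  norm_num
  ring

/-- The binomial expansion of `W (W⁻¹ - 1)^k` reduces the moments to `E[W⁻ⁿ] = M(-nσ) M(σ)ⁿ`. -/
lemma isSmallVolatilityFamily_exp_div_mgf {Y : Ω → ℝ} (hY : Measurable Y) {s : ℝ} (hs : 0 < s)
    (hpos : Integrable (fun ω => Real.exp (s * Y ω)) P)
    (hneg : Integrable (fun ω => Real.exp (-s * Y ω)) P)
    (hEY : ∫ ω, Y ω ∂P = 0) (hEY2 : ∫ ω, Y ω ^ 2 ∂P = 1) :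
    IsSmallVolatilityFamily P (fun σ ω => Real.exp (σ * Y ω) / mgf Y P σ) 0
      (1 / 4 + 2 * ((∫ ω, Y ω ^ 4 ∂P) / 24)) (-6 * ((∫ ω, Y ω ^ 3 ∂P) / 6))
      (3 / 2 + 12 * ((∫ ω, Y ω ^ 4 ∂P) / 24)) (24 * ((∫ ω, Y ω ^ 4 ∂P) / 24)) := by
  have hI : ∀ t, |t| ≤ s → Integrable (fun ω => Real.exp (t * Y ω)) P := fun t ht =>
    integrable_exp_mul_of_le_of_le hneg hpos (abs_le.1 ht).1 (abs_le.1 ht).2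
  have h0 : 0 ∈ interior (integrableExpSet Y P) := by
    refine mem_interior.2 ⟨Set.Ioo (-s) s, fun t ht => hI t (abs_le.2 ⟨ht.1.le, ht.2.le⟩),
      isOpen_Ioo, by simpa using hs⟩
  have hM := mgf_expansion h0 hEY hEY2
  obtain ⟨n2, n3, n4⟩ := isLittleO_of_mgf_expansion hM
  have hMpos : ∀ σ, |σ| ≤ s → 0 < mgf Y P σ := fun σ hσ => mgf_pos (hI σ hσ)
  have hM0 : Tendsto (mgf Y P) (𝓝 0) (𝓝 1) := by
    simpa using (differentiableAt_mgf h0).continuousAt.tendsto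
  -- Because `E[Y] = 0`, the derivative of the mgf vanishes at 0; this supplies `|M - 1| ≤ σ` for
  -- the pointwise domination.
  have hM1 : (fun σ => mgf Y P σ - 1) =o[𝓝 0] fun σ : ℝ => σ := by
    have := hasDerivAt_iff_isLittleO_nhds_zero.1 (hasDerivAt_mgf h0)
    simpa [hEY] using this
  obtain ⟨ε, hε, hMε⟩ := Metric.eventually_nhds_iff_ball.1 ((hM1.def one_pos).and
    (hM0.eventually (Icc_mem_nhds (by norm_num : (1 / 2 : ℝ) < 1) one_lt_two)))
  -- Powers down to `W⁻³` occur, so `exp (-3σY)` must be integrable: hence `s / 3`.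
  have hsmall : ∀ᶠ σ in 𝓝[>] (0 : ℝ), σ ∈ Set.Ioo 0 (s / 3) := Ioo_mem_nhdsGT (by positivity)
  have hW : ∀ σ ∈ Set.Ioo 0 (s / 3), ∀ j : ℝ, 0 ≤ j → j ≤ 3 →
      Integrable (fun ω => Real.exp (-(j * σ) * Y ω)) P := fun σ hσ j hj hj3 => by
    refine hI _ ?_
    rw [abs_neg, abs_of_nonneg (mul_nonneg hj hσ.1.le)]
    nlinarith [hσ.1, hσ.2]
  have hWint : ∀ σ ∈ Set.Ioo 0 (s / 3),
      Integrable (fun ω => Real.exp (σ * Y ω) / mgf Y P σ) P := fun σ hσ =>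
    (hI σ (by rw [abs_of_pos hσ.1]; linarith [hσ.2])).div_const _
  have hWone : ∀ σ ∈ Set.Ioo 0 (s / 3), ∫ ω, Real.exp (σ * Y ω) / mgf Y P σ ∂P = 1 := fun σ hσ => by
    rw [integral_div]
    exact div_self (hMpos σ (by rw [abs_of_pos hσ.1]; linarith [hσ.2])).ne'
  have hpt : ∀ σ ∈ Set.Ioo 0 (s / 3), ∀ ω,
      (Real.exp (σ * Y ω) / mgf Y P σ)⁻¹ = mgf Y P σ * Real.exp (-σ * Y ω) := fun σ hσ ω => by
    rw [inv_div, neg_mul, Real.exp_neg, div_eq_mul_inv]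
  have hMne : ∀ σ ∈ Set.Ioo 0 (s / 3), mgf Y P σ ≠ 0 := fun σ hσ =>
    (hMpos σ (by rw [abs_of_pos hσ.1]; linarith [hσ.2])).ne'
  have hmgf : ∀ t, ∫ ω, Real.exp (t * Y ω) ∂P = mgf Y P t := fun t => rfl
  have epow : ∀ (σ : ℝ) (n : ℕ) ω, Real.exp (-((n : ℝ) * σ) * Y ω) = Real.exp (-σ * Y ω) ^ n :=
    fun σ n ω => by rw [← Real.exp_nat_mul]; congr 1; ring
  have eone : ∀ σ ∈ Set.Ioo 0 (s / 3), ∀ ω,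
      Real.exp (σ * Y ω) / mgf Y P σ * (mgf Y P σ * Real.exp (-σ * Y ω)) = 1 := fun σ hσ ω => by
    rw [div_mul_eq_mul_div, mul_left_comm, ← Real.exp_add]
    simp [hMne σ hσ]
  refine ⟨fun σ => by fun_prop, hsmall.mono hWint, hsmall.mono hWone,
    ⟨fun ω => 2 * (1 + 20 / s) ^ 4 * Real.exp (s * |Y ω|),
      (integrable_exp_mul_abs hpos hneg).const_mul _, min ε (s / 10),
      lt_min hε (by positivity), Eventually.of_forall fun ω σ hσ => ?_⟩,
    Eventually.of_forall fun ω => ?_, ?_, ?_, ?_⟩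
  · have hσs : σ < s / 10 := hσ.2.trans_le (min_le_right _ _)
    have hσε : σ < ε := hσ.2.trans_le (min_le_left _ _)
    obtain ⟨b1, b2⟩ := hMε σ (by simpa [abs_of_pos hσ.1] using hσε)
    rw [Real.norm_eq_abs, Real.norm_eq_abs, one_mul, abs_of_pos hσ.1] at b1
    exact ⟨div_pos (Real.exp_pos _) (by linarith [b2.1]),
      exp_div_mul_pow_four_le hs hσ.1 hσs.le b1 b2.1 b2.2⟩
  · have h1 : Tendsto (fun σ => Real.exp (σ * Y ω)) (𝓝 0) (𝓝 1) := by
      have : Continuous fun σ => Real.exp (σ * Y ω) := by fun_prop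
      simpa using this.tendsto 0
    have h2 : Tendsto (fun σ => Real.exp (σ * Y ω) / mgf Y P σ) (𝓝 0) (𝓝 (1 / 1)) :=
      h1.div hM0 one_ne_zero
    rw [div_one] at h2
    exact h2.mono_left nhdsWithin_le_nhds
  · refine n2.congr' ?_ EventuallyEq.rfl
    filter_upwards [hsmall] with σ hσ
    congr 1
    have i1 := (hW σ hσ 1 (by norm_num) (by norm_num)).const_mul (mgf Y P σ)
    rw [one_mul] at i1
    have e : ∀ ω, Real.exp (σ * Y ω) / mgf Y P σ * ((Real.exp (σ * Y ω) / mgf Y P σ)⁻¹ - 1) ^ 2 =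
        mgf Y P σ * Real.exp (-σ * Y ω) - 2 + Real.exp (σ * Y ω) / mgf Y P σ := fun ω => by
      rw [hpt σ hσ]
      set z := Real.exp (-σ * Y ω)
      linear_combination ((mgf Y P σ * z) - 2) * eone σ hσ ω
    simp_rw [e]
    have i2 : Integrable (fun ω => mgf Y P σ * Real.exp (-σ * Y ω) - 2) P :=
      i1.sub (integrable_const 2)
    rw [integral_add i2 (hWint σ hσ), hWone σ hσ, integral_sub i1 (integrable_const 2),
      integral_const_mul, hmgf]
    simp only [integral_const, probReal_univ, smul_eq_mul]
    ring
  · refine n3.congr' ?_ EventuallyEq.rfl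
    filter_upwards [hsmall] with σ hσ
    congr 1
    have i1 := (hW σ hσ 1 (by norm_num) (by norm_num)).const_mul (3 * mgf Y P σ)
    have i2 := (hW σ hσ 2 (by norm_num) (by norm_num)).const_mul (mgf Y P σ ^ 2)
    rw [one_mul] at i1
    have e : ∀ ω, Real.exp (σ * Y ω) / mgf Y P σ * ((Real.exp (σ * Y ω) / mgf Y P σ)⁻¹ - 1) ^ 3 =
        mgf Y P σ ^ 2 * Real.exp (-(2 * σ) * Y ω) - 3 * mgf Y P σ * Real.exp (-σ * Y ω) + 3
          - Real.exp (σ * Y ω) / mgf Y P σ := fun ω => by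
      have e2 := epow σ 2 ω
      push_cast at e2
      rw [hpt σ hσ, e2]
      set z := Real.exp (-σ * Y ω)
      linear_combination ((mgf Y P σ * z) ^ 2 - 3 * (mgf Y P σ * z) + 3) * eone σ hσ ω
    simp_rw [e]
    have i3 : Integrable (fun ω => mgf Y P σ ^ 2 * Real.exp (-(2 * σ) * Y ω)
      - 3 * mgf Y P σ * Real.exp (-σ * Y ω)) P := i2.sub i1
    have i4 : Integrable (fun ω => mgf Y P σ ^ 2 * Real.exp (-(2 * σ) * Y ω)
      - 3 * mgf Y P σ * Real.exp (-σ * Y ω) + 3) P := i3.add (integrable_const 3)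
    rw [integral_sub i4 (hWint σ hσ), hWone σ hσ, integral_add i3 (integrable_const 3),
      integral_sub i2 i1, integral_const_mul, integral_const_mul, hmgf, hmgf]
    simp only [integral_const, probReal_univ, smul_eq_mul]
    ring
  · refine n4.congr' ?_ EventuallyEq.rfl
    filter_upwards [hsmall] with σ hσ
    congr 1
    have i1 := (hW σ hσ 1 (by norm_num) (by norm_num)).const_mul (6 * mgf Y P σ)
    have i2 := (hW σ hσ 2 (by norm_num) (by norm_num)).const_mul (4 * mgf Y P σ ^ 2)
    have i3 := (hW σ hσ 3 (by norm_num) (by norm_num)).const_mul (mgf Y P σ ^ 3)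
    rw [one_mul] at i1
    have e : ∀ ω, Real.exp (σ * Y ω) / mgf Y P σ * ((Real.exp (σ * Y ω) / mgf Y P σ)⁻¹ - 1) ^ 4 =
        mgf Y P σ ^ 3 * Real.exp (-(3 * σ) * Y ω) - 4 * mgf Y P σ ^ 2 * Real.exp (-(2 * σ) * Y ω)
          + 6 * mgf Y P σ * Real.exp (-σ * Y ω) - 4 + Real.exp (σ * Y ω) / mgf Y P σ := fun ω => by
      have e2 := epow σ 2 ω
      have e3 := epow σ 3 ω
      push_cast at e2 e3
      rw [hpt σ hσ, e2, e3]
      set z := Real.exp (-σ * Y ω)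
      linear_combination ((mgf Y P σ * z) ^ 3 - 4 * (mgf Y P σ * z) ^ 2 + 6 * (mgf Y P σ * z) - 4) * eone σ hσ ω
    simp_rw [e]
    have i4 : Integrable (fun ω => mgf Y P σ ^ 3 * Real.exp (-(3 * σ) * Y ω)
      - 4 * mgf Y P σ ^ 2 * Real.exp (-(2 * σ) * Y ω)) P := i3.sub i2
    have i5 : Integrable (fun ω => mgf Y P σ ^ 3 * Real.exp (-(3 * σ) * Y ω)
      - 4 * mgf Y P σ ^ 2 * Real.exp (-(2 * σ) * Y ω) + 6 * mgf Y P σ * Real.exp (-σ * Y ω)) P :=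
      i4.add i1
    have i6 : Integrable (fun ω => mgf Y P σ ^ 3 * Real.exp (-(3 * σ) * Y ω)
      - 4 * mgf Y P σ ^ 2 * Real.exp (-(2 * σ) * Y ω) + 6 * mgf Y P σ * Real.exp (-σ * Y ω) - 4) P :=
      i5.sub (integrable_const 4)
    rw [integral_add i6 (hWint σ hσ), hWone σ hσ, integral_sub i5 (integrable_const 4),
      integral_add i4 i1, integral_sub i3 i2, integral_const_mul, integral_const_mul,
      integral_const_mul, hmgf, hmgf, hmgf]
    simp only [integral_const, probReal_univ, smul_eq_mul]
    ring

/-- With `s` the standard deviation of `log X`, `exp (sY)` and `exp (-sY)` are constant multiples of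
`X` and `X⁻¹`, so their integrability supplies the exponential moments. -/
lemma isSmallVolatilityFamily_logNormalAsset {X : Ω → ℝ} (hX : Measurable X)
    (hXpos : ∀ᵐ ω ∂P, 0 < X ω) (hXint : Integrable X P)
    (hXinv : Integrable (fun ω => (X ω)⁻¹) P)
    (hv : 0 < variance (fun ω => Real.log (X ω)) P) :
    IsSmallVolatilityFamily P (logNormalAsset P X) 0
      (1 / 4 + 2 * (stdMoment P (fun ω => Real.log (X ω)) 4 / 24))
      (-6 * (stdMoment P (fun ω => Real.log (X ω)) 3 / 6))
      (3 / 2 + 12 * (stdMoment P (fun ω => Real.log (X ω)) 4 / 24))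
      (24 * (stdMoment P (fun ω => Real.log (X ω)) 4 / 24)) := by
  have hlog : Measurable fun ω => Real.log (X ω) := hX.log
  have hs : 0 < √(variance (fun ω => Real.log (X ω)) P) := Real.sqrt_pos.2 hv
  have hsY : ∀ ω, √(variance (fun ω => Real.log (X ω)) P) *
      standardized P (fun ω => Real.log (X ω)) ω =
      Real.log (X ω) - ∫ ω', Real.log (X ω') ∂P := fun ω => by
    unfold standardized
    rw [mul_div_cancel₀ _ hs.ne']
  refine isSmallVolatilityFamily_exp_div_mgf (measurable_standardized hlog) hs ?_ ?_
    (integral_standardized ((memLp_two_of_variance_pos hlog hv).integrable (by norm_num)))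
    (integral_standardized_sq hlog hv)
  · refine (hXint.mul_const (Real.exp (∫ ω', Real.log (X ω') ∂P))⁻¹).congr ?_
    filter_upwards [hXpos] with ω hω
    rw [hsY, Real.exp_sub, Real.exp_log hω, div_eq_mul_inv]
  · refine (hXinv.mul_const (Real.exp (∫ ω', Real.log (X ω') ∂P))).congr ?_
    filter_upwards [hXpos] with ω hω
    rw [neg_mul, hsY, neg_sub, Real.exp_sub, Real.exp_log hω, div_eq_mul_inv, mul_comm]

end LogNormal

/-! ### The two expansions -/

theorem mainTheorem6 {Ω : Type*} [MeasurableSpace Ω] (P : Measure Ω) [IsProbabilityMeasure P]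
    (X L : Ω → ℝ) (hX : Measurable X) (hL : Measurable L)
    (hXpos : ∀ᵐ ω ∂P, 0 < X ω)
    (hXL : IndepFun X L P)
    (hXint : Integrable X P) (hXinv : Integrable (fun ω => (X ω)⁻¹) P) (hLint : Integrable L P)
    (hEX : ∫ ω, X ω ∂P = 1) (hEL : ∫ ω, L ω ∂P = 0)
    (f : ℝ → ℝ) (hf : Measurable f) (hfpos : ∀ y, 0 < f y) (hfbdd : ∃ C, ∀ y, f y ≤ C)
    (hLf : P.map L = volume.withDensity (fun y => ENNReal.ofReal (f y)))
    (α : ℝ) (hα : α ∈ Set.Ioo (0 : ℝ) 1)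
    (q : ℝ) (hq : q = lawQuantile (P.map L) (1 - α))
    (hf1 : ∀ᶠ y in 𝓝 q, DifferentiableAt ℝ f y) (hf2 : DifferentiableAt ℝ (deriv f) q)
    (φ : ℝ) :
    -- expansion in the log-normal volatility
    (∀ μ₃ μ₄ : ℝ, 0 < variance (fun ω => Real.log (X ω)) P →
      μ₃ = stdMoment P (fun ω => Real.log (X ω)) 3 →
      μ₄ = stdMoment P (fun ω => Real.log (X ω)) 4 →
      (fun σ : ℝ =>
        expectedShortfall P α (surplus (logNormalAsset P X σ) L φ) -
          (expectedShortfall P α (fun ω => - L ω)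
            + σ ^ 2 / (2 * α) * (φ - q) ^ 2 * f q
            + σ ^ 3 * μ₃ / (6 * α) * (φ - q) ^ 3 * deriv f q
            + σ ^ 4 / (24 * α) *
              (μ₄ * deriv (fun y => (φ - y) ^ 4 * deriv f y) q
                - 3 * (deriv (fun y => (φ - y) ^ 2 * f y) q) ^ 2 / f q
                + (2 * μ₄ - 6) * (φ - q) ^ 3 * deriv f q
                + (μ₄ + 3) * (φ - q) ^ 2 * f q)))
        =o[𝓝[>] 0] (fun σ : ℝ => σ ^ 4)) ∧
    -- expansion in the normal volatility
    (∀ μ₃ μ₄ : ℝ, 0 < variance X P → MemLp X 4 P →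
      μ₃ = stdMoment P X 3 →
      μ₄ = stdMoment P X 4 →
      (fun σ : ℝ =>
        expectedShortfall P α (surplus (normalAsset P X σ) L φ) -
          (expectedShortfall P α (fun ω => - L ω)
            + σ ^ 2 / (2 * α) * (φ - q) ^ 2 * f q
            + σ ^ 3 * μ₃ / (6 * α) * deriv (fun y => (φ - y) ^ 3 * f y) q
            + σ ^ 4 / (24 * α) *
              (μ₄ * deriv (deriv (fun y => (φ - y) ^ 4 * f y)) q
                - 3 * (deriv (fun y => (φ - y) ^ 2 * f y) q) ^ 2 / f q)))
        =o[𝓝[>] 0] (fun σ : ℝ => σ ^ 4)) := by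
  have hα0 : α ≠ 0 := hα.1.ne'
  have hfq : f q ≠ 0 := (hfpos q).ne'
  have d0 : HasDerivAt f (deriv f q) q := hf1.self_of_nhds.hasDerivAt
  have d1 : HasDerivAt (deriv f) (deriv (deriv f) q) q := hf2.hasDerivAt
  have p (n : ℕ) (y : ℝ) : HasDerivAt (fun y => (φ - y) ^ n) (n * (φ - y) ^ (n - 1) * (-1)) y :=
    ((hasDerivAt_id' y).const_sub φ).pow n
  -- With `a = q - φ` this is `2 (a f + a² f' / 2)`, so `3 / 24` times its square over `f` is the
  -- quotient from completing the square.
  have D2 : deriv (fun y => (φ - y) ^ 2 * f y) q =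
      -2 * (φ - q) * f q + (φ - q) ^ 2 * deriv f q := by
    rw [((p 2 q).fun_mul d0).deriv]
    push_cast
    ring
  refine ⟨fun μ₃ μ₄ hv hμ₃ hμ₄ => ?_, fun μ₃ μ₄ hv hX4 hμ₃ hμ₄ => ?_⟩
  · have D4 : deriv (fun y => (φ - y) ^ 4 * deriv f y) q =
        -4 * (φ - q) ^ 3 * deriv f q + (φ - q) ^ 4 * deriv (deriv f) q := by
      rw [((p 4 q).fun_mul d1).deriv]
      push_cast
      ring
    have hind : ∀ σ, IndepFun (logNormalAsset P X σ) L P := fun σ =>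
      hXL.comp (φ := fun x => Real.exp (σ * ((Real.log x - ∫ ω', Real.log (X ω') ∂P) /
        √(variance (fun ω' => Real.log (X ω')) P))) /
        mgf (standardized P (fun ω' => Real.log (X ω'))) P σ) (by fun_prop) measurable_id
    have h := (isSmallVolatilityFamily_logNormalAsset hX hXpos hXint hXinv
      hv).expectedShortfall_isLittleO hL hind hLint hf hfpos hLf hα hq hf1 hf2 φ
    refine h.congr_left fun σ => ?_
    rw [D2, D4, ← hμ₃, ← hμ₄]
    field_simp
    ring
  · have D3 : deriv (fun y => (φ - y) ^ 3 * f y) q =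
        -3 * (φ - q) ^ 2 * f q + (φ - q) ^ 3 * deriv f q := by
      rw [((p 3 q).fun_mul d0).deriv]
      push_cast
      ring
    have D4 : deriv (deriv (fun y => (φ - y) ^ 4 * f y)) q =
        12 * (φ - q) ^ 2 * f q - 8 * (φ - q) ^ 3 * deriv f q
          + (φ - q) ^ 4 * deriv (deriv f) q := by
      -- The second derivative needs the first one on a whole neighbourhood of `q`.
      have e : deriv (fun y => (φ - y) ^ 4 * f y) =ᶠ[𝓝 q]
          fun y => -4 * ((φ - y) ^ 3 * f y) + (φ - y) ^ 4 * deriv f y := by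
        filter_upwards [hf1] with y hy
        rw [((p 4 y).fun_mul hy.hasDerivAt).deriv]
        push_cast
        ring
      rw [e.deriv_eq, ((((p 3 q).fun_mul d0).const_mul (-4)).fun_add ((p 4 q).fun_mul d1)).deriv]
      push_cast
      ring
    have hind : ∀ σ, IndepFun (normalAsset P X σ) L P := fun σ =>
      hXL.comp (φ := fun x => 1 + σ * ((x - ∫ ω', X ω' ∂P) / √(variance X P)))
        (by fun_prop) measurable_id
    have h := (isSmallVolatilityFamily_normalAsset hX hXpos hEX hv hX4).expectedShortfall_isLittleO
      hL hind hLint hf hfpos hLf hα hq hf1 hf2 φ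
    refine h.congr_left fun σ => ?_
    rw [D2, D3, D4, ← hμ₃, ← hμ₄]
    field_simp
    ring
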